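/- **Data.** Let $k$ be an algebraically closed field and $A$ an associative unital $k$-algebra whose centre $Z(A)$ is a reduced $k$-algebra of finite type, so that $Z(A)$ is the coordinate ring of an affine variety $X\subseteq k^m$. Let $\mathbf u_1,\dots,\mathbf u_d$ generate $A$ over $Z(A)$. For every $x\in X$ let $M_x$ be an irreducible $A$-module with $\dim_k M_x=n$, annihilated by the maximal ideal of $x$, with bases $e^\alpha(x)=(e^\alpha_1(x),\dots,e^\alpha_n(x))$ ("canonical bases"), where $\alpha$ ranges over a finite set $B$. Let $f_1,\dots,f_r$ be polynomials over $k$ in the coordinates of $x\in X$ and in the entries of $t=(t^l_{ij})_{1\le i,j\le n,\,1\le l\le d}$, such that for all $x\in X$ and all $t$ with $f_1(t,x)=\dots=f_r(t,x)=0$ there is $\alpha\in B$ with $\mathbf u_l e^\alpha_j(x)=\sum_i t^l_{ij}e^\alpha_i(x)$ for all $l,j$ (one says that $e^\alpha(x)$ realises $(x,t)$). Let $Y\subseteq X\times\mathbb A^{dn^2}$ be defined by $f_1=\dots=f_r=0$. Assume that $Y\to X$ is a Galois cover with finite group $\Gamma$; of this only the following is used: $Y\to X$ is surjective, and $\Gamma$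 acts on $Y$ over $X$ by regular maps, simply transitively on each fibre. Finally, for $\gamma\in\Gamma$ let $g_\gamma:Y\to \mathrm{GL}_n(k)$ be regular on $Y$, such that whenever $e^\alpha(x)$ realises $y\in Y$ and $e^\beta(x)$ realises $\gamma y$ ($x$ being the image of $y$), there is $\lambda\in k^\times$ with $e^\beta_j(x)=\lambda\sum_i (g_\gamma(y))_{ij}e^\alpha_i(x)$ for all $j$. It follows that $g_\gamma(y)\,g_\delta(\gamma y)\,g_{\delta\gamma}(y)^{-1}=c_{\gamma,\delta}(y)\cdot 1$ with $c_{\gamma,\delta}(y)\in k^\times$. **The geometry.** A quantum Zariski geometry for these data is a two-sorted structure $(V,k)$ with: the field structure of $k$; a projection $p:V\to X\subseteq k^m$; the graphs of addition and scalar multiplication making each fibre $V_x=p^{-1}(x)$ a $k$-vector space; and maps $\mathbf u_1,\dots,\mathbf u_d:V\to V$, linear on each fibre, such that for every $(x,t)\in Y$ there is a basis of $V_x$ in which $\mathbf u_l$ acts by the matrix $t^l$ for all $l$. **The splitting groupoid** $S_\bullet$ has objects $S_0=Y$, arrows $S_1=(Y\times_X Y)\times k^\times$ (an arrow $(y,y',a)$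 going from $y$ to $y'$), and composition, written from left to right, $(y,\gamma y,a)\circ(\gamma y,\delta\gamma y,b)=(y,\delta\gamma y,\,c_{\gamma,\delta}(y)\,ab)$. Its groupoid quotient (the set of isomorphism classes of objects) is $[S_\bullet]=X$. **Torsors.** An $S_\bullet$-torsor over $[S_\bullet]$ is a set $P$ with an anchor map $P\to S_0$ and an action of the arrows of $S_\bullet$ (an arrow with source $y$ sends the points anchored at $y$ to points anchored at its target, compatibly with identities and composition) such that the induced projection $P\to[S_\bullet]$, taking a point to the class of its anchor, is surjective and any two points with the same projection are related by a unique arrow. The generalised imaginary sort given by $P$ is the two-sorted structure $(k,P)$ with the field structure of $k$, the anchor map, the projection, and the action. The groupoid $S_\bullet$ is eliminable if some $S_\bullet$-torsor over $[S_\bullet]$ is definable in the field $k$. Definability and interpretability are meant with parameters. An interpretation is a presentation by tuples from a definable set modulo a definable equivalence relation; it is said to be over $k$ if the interpreted copy of the field sort $k$ is definably identified with the field sort $k$ of the interpreting structure. **Theorem.** For every quantum Zariski geometry $(V,k)$ for data as above: 1. $S_\bullet$ is a groupoid definable in the field $k$, and it has a torsor over $[S_\bullet]$. 2. For every $S_\bullet$-torsor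 $P$ over $[S_\bullet]$, the generalised imaginary sort $(k,P)$ is interpretable over $k$ in $(V,k)$. 3. Conversely, for every such $P$, the geometry $(V,k)$ is interpretable over $k$ (that is, definable, allowing quotients by definable equivalence relations) in $(k,P)$, the algebraically closed field expanded by the generalised imaginary sort. 4. In particular, if $S_\bullet$ is eliminable, then $(V,k)$ is interpretable, over $k$, in the pure algebraically closed field $k$. -/

import Mathlib

universe u v w w' w₁ w₂

open FirstOrder

/-! ## First-order interpretations (with parameters) -/

/-- The field `k` as a structure in the language of rings (the pure field). -/
noncomputable instance pureFieldStructure (k : Type u) [Field k] : Language.ring.Structure k :=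
  (FirstOrder.Ring.compatibleRingOfRing k).toStructure

/-- An interpretation, with parameters, of the structure `N` in the structure `M`: elements of `N`
are represented by the tuples of a definable set `dom ⊆ M ^ dim`, modulo a definable equivalence
relation, so that all basic relations and graphs of basic functions of `N` become definable. -/
structure Interpretation (L : Language) (M : Type u) [L.Structure M]
    (L' : Language) (N : Type v) [L'.Structure N] where
  dim : ℕ
  dom : Set (Fin dim → M)
  map : dom → N
  map_surjective : Function.Surjective map
  dom_definable : (Set.univ : Set M).Definable L dom
  eq_definable : (Set.univ : Set M).Definable L
    {v : Fin 2 × Fin dim → M | ∃ a : Fin 2 → dom,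
      (∀ i c, v (i, c) = (a i).1 c) ∧ map (a 0) = map (a 1)}
  rel_definable : ∀ {j : ℕ} (R : L'.Relations j), (Set.univ : Set M).Definable L
    {v : Fin j × Fin dim → M | ∃ a : Fin j → dom,
      (∀ i c, v (i, c) = (a i).1 c) ∧ Language.Structure.RelMap R (fun i => map (a i))}
  fun_definable : ∀ {j : ℕ} (F : L'.Functions j), (Set.univ : Set M).Definable L
    {v : Fin (j + 1) × Fin dim → M | ∃ a : Fin (j + 1) → dom,
      (∀ i c, v (i, c) = (a i).1 c) ∧
        Language.Structure.funMap F (fun i => map (a i.castSucc)) = map (a (Fin.last j))}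

/-- `N` is interpretable in `M` over a common sort `K` (embedded in `M` by `ι` and in `N` by `ι'`):
there is an interpretation of `N` in `M` in which the copy of `K` inside the interpreted structure
is identified with the copy of `K` inside `M` by a definable map. -/
def InterpretableOver (L : Language) (M : Type u) [L.Structure M]
    (L' : Language) (N : Type v) [L'.Structure N] {K : Type w} (ι : K → M) (ι' : K → N) : Prop :=
  ∃ I : Interpretation L M L' N, (Set.univ : Set M).Definable L
    {v : Option (Fin I.dim) → M | ∃ (c : K) (a : I.dom),
      v none = ι c ∧ (∀ i, v (some i) = a.1 i) ∧ I.map a = ι' c}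

/-- Definability, with parameters, in the pure field `k`. -/
def FieldDefinable (k : Type u) [Field k] {α : Type v} (s : Set (α → k)) : Prop :=
  (Set.univ : Set k).Definable Language.ring s

/-! ## Groupoids, torsors, generalised imaginary sorts -/

/-- A small groupoid whose objects, arrows and isomorphism classes of objects are given by tuples
from `k` (through the codings `objCode`, `arrCode`, `quotCode`). Composition is written from left to
right: `comp f h` is "first `f`, then `h`". The groupoid quotient is the range of `quotCode`. -/
structure TupleGroupoid (k : Type u) where
  Obj : Type v
  Arr : Type v
  src : Arr → Obj
  tgt : Arr → Obj
  one : Obj → Arr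
  inv : Arr → Arr
  comp : (f h : Arr) → tgt f = src h → Arr
  src_one : ∀ x, src (one x) = x
  tgt_one : ∀ x, tgt (one x) = x
  src_inv : ∀ f, src (inv f) = tgt f
  tgt_inv : ∀ f, tgt (inv f) = src f
  src_comp : ∀ f h e, src (comp f h e) = src f
  tgt_comp : ∀ f h e, tgt (comp f h e) = tgt h
  one_comp : ∀ f, comp (one (src f)) f (tgt_one _) = f
  comp_one : ∀ f, comp f (one (tgt f)) (src_one _).symm = f
  comp_assoc : ∀ f h l (e : tgt f = src h) (e' : tgt h = src l),
    comp (comp f h e) l ((tgt_comp f h e).trans e') =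
      comp f (comp h l e') (e.trans (src_comp h l e').symm)
  comp_inv : ∀ f, comp f (inv f) (src_inv f).symm = one (src f)
  inv_comp : ∀ f, comp (inv f) f (tgt_inv f) = one (tgt f)
  objDim : ℕ
  arrDim : ℕ
  quotDim : ℕ
  objCode : Obj → Fin objDim → k
  arrCode : Arr → Fin arrDim → k
  quotCode : Obj → Fin quotDim → k
  objCode_injective : Function.Injective objCode
  arrCode_injective : Function.Injective arrCode
  quotCode_eq_iff : ∀ x y, quotCode x = quotCode y ↔ ∃ f, src f = x ∧ tgt f = y

namespace TupleGroupoid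

variable {k : Type u}

/-- The groupoid is definable in the pure field `k`: its sets of objects and arrows are definable,
and so are its structure maps and the quotient map on objects. -/
structure IsDefinable [Field k] (G : TupleGroupoid.{u, v} k) : Prop where
  obj : FieldDefinable k (Set.range G.objCode)
  arr : FieldDefinable k (Set.range G.arrCode)
  src : FieldDefinable k (Set.range fun f => Sum.elim (G.arrCode f) (G.objCode (G.src f)))
  tgt : FieldDefinable k (Set.range fun f => Sum.elim (G.arrCode f) (G.objCode (G.tgt f)))
  one : FieldDefinable k (Set.range fun x => Sum.elim (G.objCode x) (G.arrCode (G.one x)))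
  inv : FieldDefinable k (Set.range fun f => Sum.elim (G.arrCode f) (G.arrCode (G.inv f)))
  comp : FieldDefinable k {v : Fin G.arrDim ⊕ Fin G.arrDim ⊕ Fin G.arrDim → k | ∃ f h e,
    v = Sum.elim (G.arrCode f) (Sum.elim (G.arrCode h) (G.arrCode (G.comp f h e)))}
  quot : FieldDefinable k (Set.range fun x => Sum.elim (G.objCode x) (G.quotCode x))

/-- A torsor `P` for the groupoid `G` over its quotient `[G]`: an anchor map to the objects and an
action of arrows on the points of `P` anchored at their source. The projection of `P` to `[G]`
sends a point to the isomorphism class of its anchor; it is onto, and any two points of the same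
fibre are related by a unique arrow. -/
structure Torsor (G : TupleGroupoid.{u, v} k) (P : Type w) where
  anchor : P → G.Obj
  act : (p : P) → (f : G.Arr) → anchor p = G.src f → P
  anchor_act : ∀ p f e, anchor (act p f e) = G.tgt f
  act_one : ∀ p, act p (G.one (anchor p)) (G.src_one _).symm = p
  act_comp : ∀ p f h (e : anchor p = G.src f) (e' : G.tgt f = G.src h),
    act (act p f e) h ((anchor_act p f e).trans e') =
      act p (G.comp f h e') (e.trans (G.src_comp f h e').symm)
  proj_surjective : ∀ x : G.Obj, ∃ p, G.quotCode (anchor p) = G.quotCode x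
  principal : ∀ p p', G.quotCode (anchor p) = G.quotCode (anchor p') → ∃! f, ∃ e, act p f e = p'

/-- `G` is eliminable: there is a `G`-torsor over `[G]` definable in the pure field `k`. -/
def Eliminable [Field k] (G : TupleGroupoid.{u, v} k) : Prop :=
  ∃ (r : ℕ) (P : Set (Fin r → k)) (T : G.Torsor P), FieldDefinable k P ∧
    FieldDefinable k (Set.range fun p : P => Sum.elim p.1 (G.objCode (T.anchor p))) ∧
    FieldDefinable k (Set.range fun p : P => Sum.elim p.1 (G.quotCode (T.anchor p))) ∧
    FieldDefinable k {v : Fin r ⊕ Fin G.arrDim ⊕ Fin r → k | ∃ p f e,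
      v = Sum.elim p.1 (Sum.elim (G.arrCode f) (T.act p f e).1)}

end TupleGroupoid

/-- Basic relations on a field with an additional sort carrying a groupoid torsor. -/
inductive ImagRel (a b c : ℕ) : ℕ → Type
  | isField : ImagRel a b c 1
  | add : ImagRel a b c 3
  | mul : ImagRel a b c 3
  | anchor : ImagRel a b c (a + 1)
  | proj : ImagRel a b c (c + 1)
  | act : ImagRel a b c (b + 2)

/-- The language of a generalised imaginary sort. -/
def imagLang (a b c : ℕ) : Language := ⟨fun _ => Empty, ImagRel a b c⟩

/-- The language of the generalised imaginary sort for the groupoid `G`. -/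
abbrev TupleGroupoid.Torsor.lang {k : Type u} {G : TupleGroupoid.{u, v} k} {P : Type w}
    (_ : G.Torsor P) : Language := imagLang G.objDim G.arrDim G.quotDim

/-- The universe of the generalised imaginary sort given by the torsor `T`: the disjoint union of
the two sorts `k` and `P`. -/
def TupleGroupoid.Torsor.Carrier {k : Type u} {G : TupleGroupoid.{u, v} k} {P : Type w}
    (_ : G.Torsor P) : Type (max u w) := k ⊕ P

/-- The field sort. -/
def TupleGroupoid.Torsor.ofField {k : Type u} {G : TupleGroupoid.{u, v} k} {P : Type w}
    (T : G.Torsor P) : k → T.Carrier := Sum.inl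

/-- The torsor sort. -/
def TupleGroupoid.Torsor.ofPoint {k : Type u} {G : TupleGroupoid.{u, v} k} {P : Type w}
    (T : G.Torsor P) : P → T.Carrier := Sum.inr

/-- The generalised imaginary sort: the expansion of the field `k` by the sort `P`, with the anchor
map to the objects, the projection to the quotient, and the action of the arrows. -/
instance TupleGroupoid.Torsor.imagStructure {k : Type u} [Field k] {G : TupleGroupoid.{u, v} k}
    {P : Type w} (T : G.Torsor P) :
    T.lang.Structure T.Carrier where
  funMap := fun f => f.elim
  RelMap := fun {j} (R : ImagRel G.objDim G.arrDim G.quotDim j) => match j, R with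
    | _, .isField => fun v => ∃ a : k, v 0 = T.ofField a
    | _, .add => fun v => ∃ a b : k, v = ![T.ofField a, T.ofField b, T.ofField (a + b)]
    | _, .mul => fun v => ∃ a b : k, v = ![T.ofField a, T.ofField b, T.ofField (a * b)]
    | _, .anchor => fun v => ∃ p : P,
        v = Fin.cons (T.ofPoint p) fun i => T.ofField (G.objCode (T.anchor p) i)
    | _, .proj => fun v => ∃ p : P,
        v = Fin.cons (T.ofPoint p) fun i => T.ofField (G.quotCode (T.anchor p) i)
    | _, .act => fun v => ∃ p f e, v = Fin.cons (T.ofPoint p)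
        (Fin.cons (T.ofPoint (T.act p f e)) fun i => T.ofField (G.arrCode f i))

/-! ## Quantum Zariski geometries -/

/-- Input data: an associative unital algebra `A` whose centre is a reduced algebra of finite type
over `k`, hence the coordinate ring of an affine variety `X ⊆ k ^ m`; the points of `X` (that is,
of the maximal spectrum of the centre) are the `k`-algebra homomorphisms `Z(A) → k`. -/
structure QZGData (k : Type u) (A : Type v) [Field k] [Ring A] [Algebra k A] where
  /-- coordinate functions on `X` -/
  m : ℕ
  z : Fin m → Subalgebra.center k A
  adjoin_z : Algebra.adjoin k (Set.range z) = ⊤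
  reduced : IsReduced (Subalgebra.center k A)
  /-- irreducible modules of dimension `n`, one for each point of `X` and annihilated by it -/
  n : ℕ
  M : (Subalgebra.center k A →ₐ[k] k) → Type w
  [addCommGroupM : ∀ x, AddCommGroup (M x)]
  [moduleM : ∀ x, Module k (M x)]
  [algModuleM : ∀ x, Module A (M x)]
  [towerM : ∀ x, IsScalarTower k A (M x)]
  simpleM : ∀ x, IsSimpleModule A (M x)
  finrankM : ∀ x, Module.finrank k (M x) = n
  annihM : ∀ x (c : Subalgebra.center k A), x c = 0 → ∀ a : M x, (c : A) • a = 0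
  /-- generators of `A` over its centre -/
  d : ℕ
  gen : Fin d → A
  adjoin_gen : Algebra.adjoin k ((Subalgebra.center k A : Set A) ∪ Set.range gen) = ⊤
  /-- canonical bases -/
  B : Type
  [finiteB : Finite B]
  e : B → ∀ x, Module.Basis (Fin n) k (M x)
  /-- the polynomial system in the coordinates of `x` and in the entries of `d` matrices `t` -/
  r : ℕ
  f : Fin r → MvPolynomial (Fin m ⊕ Fin d × Fin n × Fin n) k
  exists_canonical : ∀ x (t : Fin d → Matrix (Fin n) (Fin n) k),
    (∀ l, MvPolynomial.eval (Sum.elim (fun i => x (z i)) fun q => t q.1 q.2.1 q.2.2) (f l) = 0) →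
      ∃ α, ∀ l j, gen l • e α x j = ∑ i, t l i j • e α x i

attribute [instance] QZGData.addCommGroupM QZGData.moduleM QZGData.algModuleM QZGData.towerM

namespace QZGData

variable {k : Type u} {A : Type v} [Field k] [Ring A] [Algebra k A]

/-- The points of the variety `X`. -/
abbrev X (_ : QZGData.{u, v, w} k A) : Type (max u v) := Subalgebra.center k A →ₐ[k] k

/-- The embedding of `X` into `k ^ m`. -/
def xCode (D : QZGData.{u, v, w} k A) (x : D.X) : Fin D.m → k := fun i => x (D.z i)

/-- The coordinates of a point of `X × 𝔸 ^ (d n²)`. -/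
def coords (D : QZGData.{u, v, w} k A) (x : D.X) (t : Fin D.d → Matrix (Fin D.n) (Fin D.n) k) :
    Fin D.m ⊕ Fin D.d × Fin D.n × Fin D.n → k :=
  Sum.elim (D.xCode x) fun q => t q.1 q.2.1 q.2.2

/-- The points of the variety `Y ⊆ X × 𝔸 ^ (d n²)` defined by the equations `f_l (t, x) = 0`. -/
def Y (D : QZGData.{u, v, w} k A) : Type (max u v) :=
  {y : D.X × (Fin D.d → Matrix (Fin D.n) (Fin D.n) k) //
    ∀ l, MvPolynomial.eval (D.coords y.1 y.2) (D.f l) = 0}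

variable {D : QZGData.{u, v, w} k A}

/-- The projection `Y → X`. -/
def Y.x (y : D.Y) : D.X := y.1.1

/-- The matrices at a point of `Y`. -/
def Y.t (y : D.Y) : Fin D.d → Matrix (Fin D.n) (Fin D.n) k := y.1.2

/-- The coordinates of a point of `Y`. -/
def Y.coords (y : D.Y) : Fin D.m ⊕ Fin D.d × Fin D.n × Fin D.n → k := D.coords y.x y.t

/-- A function on `Y` is regular if it is the restriction of a polynomial. -/
def IsRegular (φ : D.Y → k) : Prop :=
  ∃ q : MvPolynomial (Fin D.m ⊕ Fin D.d × Fin D.n × Fin D.n) k,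
    ∀ y, φ y = MvPolynomial.eval y.coords q

/-- In the canonical basis `e^α(x)` the generators of `A` act by the matrices `t`. -/
def Realises (D : QZGData.{u, v, w} k A) (α : D.B) (x : D.X)
    (t : Fin D.d → Matrix (Fin D.n) (Fin D.n) k) : Prop :=
  ∀ l j, D.gen l • D.e α x j = ∑ i, t l i j • D.e α x i

end QZGData

/-- The Galois part of the input data: `Y → X` is a cover with finite group `Γ`, which acts on `Y`
by regular maps, simply transitively on the fibres over the points of `X`; and
`g : Γ × Y → GL_n(k)` is an everywhere regular map that describes, up to scalars, the transition
from canonical bases with matrices given by `y` to those with matrices given by `γ • y`. -/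
structure QZGCover {k : Type u} {A : Type v} [Field k] [Ring A] [Algebra k A]
    (D : QZGData.{u, v, w} k A) (Γ : Type w') [Group Γ] [MulAction Γ D.Y] where
  finite : Finite Γ
  x_smul : ∀ (γ : Γ) (y : D.Y), (γ • y).x = y.x
  surjective : ∀ x : D.X, ∃ y : D.Y, y.x = x
  simply_transitive : ∀ y y' : D.Y, y.x = y'.x → ∃! γ : Γ, γ • y = y'
  smul_regular : ∀ (γ : Γ) l i j, QZGData.IsRegular fun y : D.Y => (γ • y).t l i j
  g : Γ → D.Y → GL (Fin D.n) k
  g_regular : ∀ γ i j, QZGData.IsRegular fun y : D.Y => (g γ y).1 i j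
  transition : ∀ (γ : Γ) (y : D.Y) (α β : D.B),
    D.Realises α y.x y.t → D.Realises β y.x (γ • y).t →
      ∃ c : kˣ, ∀ j, D.e β y.x j = (c : k) • ∑ i, (g γ y).1 i j • D.e α y.x i

/-! ### The splitting groupoid -/

namespace QZGData

variable {k : Type u} {A : Type v} [Field k] [Ring A] [Algebra k A] {D : QZGData.{u, v, w} k A}

theorem exists_realises (y : D.Y) : ∃ α, D.Realises α y.x y.t :=
  D.exists_canonical y.x y.t y.2

theorem nonempty_fin (y : D.Y) : Nonempty (Fin D.n) := by
  have := D.simpleM y.x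
  have : Nontrivial (D.M y.x) := IsSimpleModule.nontrivial A (D.M y.x)
  obtain ⟨α, -⟩ := exists_realises y
  exact (D.e α y.x).index_nonempty

theorem center_smul (x : D.X) (c : Subalgebra.center k A) (a : D.M x) : (c : A) • a = x c • a := by
  have h := D.annihM x (c - algebraMap k _ (x c)) (by simp) a
  simp only [Subalgebra.coe_sub, sub_smul, sub_eq_zero] at h
  rw [h]
  exact algebraMap_smul A (x c) a

theorem smul_combination {x : D.X} {α : D.B} {t : Fin D.d → Matrix (Fin D.n) (Fin D.n) k}
    (h : D.Realises α x t) (l : Fin D.d) (C : Matrix (Fin D.n) (Fin D.n) k) (j : Fin D.n) :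
    D.gen l • ∑ i, C i j • D.e α x i = ∑ i, (t l * C) i j • D.e α x i := by
  simp only [Finset.smul_sum, Matrix.mul_apply, Finset.sum_smul]
  rw [Finset.sum_comm]
  refine Finset.sum_congr rfl fun i _ => ?_
  rw [smul_comm, h l i, Finset.smul_sum]
  exact Finset.sum_congr rfl fun p _ => by rw [smul_smul, mul_comm]

/-- A matrix that commutes with the matrices at a point of `Y` is scalar. -/
theorem schur [IsAlgClosed k] (y : D.Y) (C : Matrix (Fin D.n) (Fin D.n) k)
    (hC : ∀ l, y.t l * C = C * y.t l) : ∃ c : k, C = Matrix.scalar _ c := by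
  obtain ⟨α, hα⟩ := exists_realises y
  set b := D.e α y.x
  have := D.simpleM y.x
  have : FiniteDimensional k (D.M y.x) := Module.Finite.of_basis b
  let φ : D.M y.x →ₗ[k] D.M y.x := Matrix.toLin b b C
  have hφ : ∀ j, φ (b j) = ∑ i, C i j • b i := fun j => Matrix.toLin_self b b C j
  have hgen : ∀ (l : Fin D.d) a, φ (D.gen l • a) = D.gen l • φ a := by
    intro l a
    have : φ ∘ₗ Module.toModuleEnd k (S := A) (D.M y.x) (D.gen l) =
        Module.toModuleEnd k (S := A) (D.M y.x) (D.gen l) ∘ₗ φ := by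
      refine b.ext fun j => ?_
      change φ (D.gen l • b j) = D.gen l • φ (b j)
      rw [hα l j, hφ, smul_combination hα, hC, map_sum]
      simp only [map_smul, Matrix.mul_apply, Finset.sum_smul]
      rw [Finset.sum_comm]
      refine Finset.sum_congr rfl fun i _ => ?_
      change _ • φ (b i) = _
      rw [hφ, Finset.smul_sum]
      exact Finset.sum_congr rfl fun p _ => by rw [smul_smul, mul_comm]
    exact LinearMap.congr_fun this a
  have hA : ∀ (s : A) a, φ (s • a) = s • φ a := by
    intro s
    have hs : s ∈ Algebra.adjoin k ((Subalgebra.center k A : Set A) ∪ Set.range D.gen) := by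
      rw [D.adjoin_gen]; trivial
    induction hs using Algebra.adjoin_induction with
    | mem s hs =>
      rcases hs with hs | ⟨l, rfl⟩
      · intro a
        have := center_smul y.x ⟨s, hs⟩
        simp only at this
        rw [this, this, map_smul]
      · exact hgen l
    | algebraMap c => intro a; rw [algebraMap_smul, algebraMap_smul, map_smul]
    | add s s' _ _ h h' => intro a; rw [add_smul, add_smul, map_add, h, h']
    | mul s s' _ _ h h' => intro a; rw [mul_smul, mul_smul, h, h']
  let ψ : Module.End A (D.M y.x) := { toFun := φ, map_add' := map_add φ, map_smul' := hA }
  obtain ⟨c, hc⟩ := (IsSimpleModule.algebraMap_end_bijective_of_isAlgClosed k).2 ψ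
  refine ⟨c, ?_⟩
  have : φ = c • LinearMap.id := by
    ext a
    exact (LinearMap.congr_fun hc a).symm
  apply (Matrix.toLin b b).injective
  change φ = _
  rw [this, Matrix.scalar_apply, ← Matrix.smul_one_eq_diagonal, map_smul, Matrix.toLin_one]

end QZGData

namespace QZGCover

variable {k : Type u} {A : Type v} [Field k] [Ring A] [Algebra k A]
  {D : QZGData.{u, v, w} k A} {Γ : Type w'} [Group Γ] [MulAction Γ D.Y]
  (S : QZGCover D Γ)

open Matrix.GeneralLinearGroup (scalar)

theorem intertwines (γ : Γ) (y : D.Y) (l : Fin D.d) :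
    y.t l * (S.g γ y).1 = (S.g γ y).1 * (γ • y).t l := by
  obtain ⟨α, hα⟩ := QZGData.exists_realises y
  obtain ⟨β, hβ⟩ := QZGData.exists_realises (γ • y)
  rw [S.x_smul] at hβ
  obtain ⟨c, hc⟩ := S.transition γ y α β hα hβ
  have key : ∀ j, ∑ i, (y.t l * (S.g γ y).1) i j • D.e α y.x i =
      ∑ i, ((S.g γ y).1 * (γ • y).t l) i j • D.e α y.x i := by
    intro j
    have h := hβ l j
    simp only [hc] at h
    rw [smul_comm, QZGData.smul_combination hα] at h
    simp only [smul_comm _ (c : k), ← Finset.smul_sum] at h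
    have h := smul_right_injective _ c.ne_zero h
    rw [h]
    simp only [Matrix.mul_apply, Finset.sum_smul, Finset.smul_sum]
    rw [Finset.sum_comm]
    refine Finset.sum_congr rfl fun i _ => Finset.sum_congr rfl fun p _ => ?_
    rw [smul_smul, mul_comm]
  ext p j
  have h := congrArg (fun a => ⇑((D.e α y.x).repr a)) (key j)
  have h1 := (D.e α y.x).repr_sum_self fun i => (y.t l * (S.g γ y).1) i j
  have h2 := (D.e α y.x).repr_sum_self fun i => ((S.g γ y).1 * (γ • y).t l) i j
  exact congrFun (h1.symm.trans (h.trans h2)) p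

/-- Modulo scalars, `g` is a 1-cocycle. -/
theorem exists_cocycle [IsAlgClosed k] (γ δ : Γ) (y : D.Y) :
    ∃ c : kˣ, S.g γ y * S.g δ (γ • y) * (S.g (δ * γ) y)⁻¹ = scalar (Fin D.n) c := by
  have h3 : ∀ l, y.t l * (S.g γ y * S.g δ (γ • y) * (S.g (δ * γ) y)⁻¹).1 =
      (S.g γ y * S.g δ (γ • y) * (S.g (δ * γ) y)⁻¹).1 * y.t l := by
    intro l
    have h1 := S.intertwines γ y l
    have h2 := S.intertwines δ (γ • y) l
    have h4 := S.intertwines (δ * γ) y l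
    rw [mul_smul] at h4
    have h5 : (δ • γ • y).t l * (S.g (δ * γ) y)⁻¹.1 = (S.g (δ * γ) y)⁻¹.1 * y.t l := by
      have e1 : (S.g (δ * γ) y)⁻¹.1 * (S.g (δ * γ) y).1 = 1 := Units.inv_mul _
      have e2 : (S.g (δ * γ) y).1 * (S.g (δ * γ) y)⁻¹.1 = 1 := Units.mul_inv _
      calc _ = (S.g (δ * γ) y)⁻¹.1 * ((S.g (δ * γ) y).1 * (δ • γ • y).t l) *
              (S.g (δ * γ) y)⁻¹.1 := by rw [← mul_assoc, e1, one_mul]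
        _ = _ := by rw [← h4, mul_assoc, mul_assoc, e2, mul_one]
    simp only [Units.val_mul]
    rw [← mul_assoc, ← mul_assoc, h1, mul_assoc _ _ (S.g δ (γ • y)).1, h2, mul_assoc, mul_assoc,
      mul_assoc, h5, ← mul_assoc]
  obtain ⟨c, hc⟩ := QZGData.schur y _ h3
  have := QZGData.nonempty_fin y
  have hc0 : c ≠ 0 := by
    rintro rfl
    have := (S.g γ y * S.g δ (γ • y) * (S.g (δ * γ) y)⁻¹).ne_zero
    rw [hc, map_zero] at this
    exact this rfl
  exact ⟨Units.mk0 c hc0, Units.ext hc⟩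

/-- The 2-cocycle `g(γ) γ(g(δ)) g(δγ)⁻¹` with values in the invertible functions on `Y`, where
`γ(g(δ))(y) = g(δ)(γ • y)`. -/
noncomputable def cocycle [IsAlgClosed k] (γ δ : Γ) (y : D.Y) : kˣ :=
  (S.exists_cocycle γ δ y).choose

theorem cocycle_spec [IsAlgClosed k] (γ δ : Γ) (y : D.Y) :
    S.g γ y * S.g δ (γ • y) = scalar (Fin D.n) (S.cocycle γ δ y) * S.g (δ * γ) y := by
  rw [← mul_inv_eq_iff_eq_mul]
  exact (S.exists_cocycle γ δ y).choose_spec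

/-- The arrows of the splitting groupoid: the elements of `(Y ×_X Y) × kˣ`. -/
@[ext]
structure Arrow (D : QZGData.{u, v, w} k A) where
  src : D.Y
  tgt : D.Y
  scal : kˣ
  fibre : src.x = tgt.x

/-- The element of `Γ` that takes `y` to `y'`, for `y`, `y'` in the same fibre. -/
noncomputable def elt {y y' : D.Y} (h : y.x = y'.x) : Γ := (S.simply_transitive y y' h).choose

theorem elt_smul {y y' : D.Y} (h : y.x = y'.x) : S.elt h • y = y' :=
  (S.simply_transitive y y' h).choose_spec.1

theorem elt_eq {y y' : D.Y} (h : y.x = y'.x) {γ : Γ} (e : γ • y = y') : S.elt h = γ :=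
  ((S.simply_transitive y y' h).choose_spec.2 γ e).symm

/-- Composition, from left to right:
`(y, γy, a) ∘ (γy, δγy, b) = (y, δγy, g(γ) γ(g(δ)) g(δγ)⁻¹ a b)`. -/
noncomputable def comp [IsAlgClosed k] (p q : Arrow D) (h : p.tgt = q.src) : Arrow D where
  src := p.src
  tgt := q.tgt
  scal := S.cocycle (S.elt p.fibre) (S.elt q.fibre) p.src * p.scal * q.scal
  fibre := p.fibre.trans ((congrArg QZGData.Y.x h).trans q.fibre)

/-- The identity arrows for this composition. -/
noncomputable def one [IsAlgClosed k] (y : D.Y) : Arrow D where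
  src := y
  tgt := y
  scal := (S.cocycle 1 1 y)⁻¹
  fibre := rfl

/-- The inverse arrows for this composition. -/
noncomputable def inv [IsAlgClosed k] (p : Arrow D) : Arrow D where
  src := p.tgt
  tgt := p.src
  scal := (S.cocycle (S.elt p.fibre) (S.elt p.fibre)⁻¹ p.src * S.cocycle 1 1 p.src * p.scal)⁻¹
  fibre := p.fibre.symm

/-- The matrix `a g(γ)(y)` of the arrow `(y, γy, a)`. -/
noncomputable def mat (p : Arrow D) : GL (Fin D.n) k :=
  scalar (Fin D.n) p.scal * S.g (S.elt p.fibre) p.src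

theorem arrow_ext {p q : Arrow D} (h1 : p.src = q.src) (h2 : p.tgt = q.tgt)
    (h3 : S.mat p = S.mat q) : p = q := by
  obtain ⟨y, y', a, h⟩ := p
  obtain ⟨z, z', b, h'⟩ := q
  obtain rfl : y = z := h1
  obtain rfl : y' = z' := h2
  have h4 : scalar (Fin D.n) a = scalar (Fin D.n) b := mul_right_cancel h3
  obtain ⟨i⟩ := QZGData.nonempty_fin y
  have h5 := congrArg (fun C : GL (Fin D.n) k => C.1 i i) h4
  have h6 : a = b := by
    ext
    simpa [Matrix.GeneralLinearGroup.coe_scalar, Matrix.scalar_apply] using h5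
  rw [h6]

/-- The coordinates of a point of `Y ⊆ X × 𝔸 ^ (d n²)` as a single tuple. -/
def yCode (y : D.Y) : Fin (D.m + D.d * (D.n * D.n)) → k :=
  Fin.append (D.xCode y.x) fun q =>
    y.t (finProdFinEquiv.symm q).1 (finProdFinEquiv.symm (finProdFinEquiv.symm q).2).1
      (finProdFinEquiv.symm (finProdFinEquiv.symm q).2).2

/-- An arrow `(y, y', a)` as a single tuple. -/
def arrCode (p : Arrow D) : Fin (D.m + D.d * (D.n * D.n) + (D.m + D.d * (D.n * D.n)) + 1) → k :=
  Fin.append (Fin.append (yCode p.src) (yCode p.tgt)) fun _ => (p.scal : k)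

theorem xCode_injective : Function.Injective D.xCode := by
  intro x x' h
  refine AlgHom.ext_of_adjoin_eq_top D.adjoin_z ?_
  rintro _ ⟨i, rfl⟩
  exact congrFun h i

theorem append_inj {K : Type u} {a b : ℕ} {v v' : Fin a → K} {q q' : Fin b → K}
    (h : Fin.append v q = Fin.append v' q') : v = v' ∧ q = q' := by
  constructor
  · ext i
    simpa using congrFun h (Fin.castAdd b i)
  · ext i
    simpa using congrFun h (Fin.natAdd a i)

theorem yCode_injective : Function.Injective (yCode (D := D)) := by
  intro y y' h
  obtain ⟨h1, h2⟩ := append_inj h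
  refine Subtype.ext (Prod.ext (xCode_injective h1) ?_)
  ext l i j
  simpa [QZGData.Y.t] using congrFun h2 (finProdFinEquiv (l, finProdFinEquiv (i, j)))

theorem arrCode_injective : Function.Injective (arrCode (D := D)) := by
  intro p q h
  obtain ⟨h1, h2⟩ := append_inj h
  obtain ⟨h3, h4⟩ := append_inj h1
  exact Arrow.ext (yCode_injective h3) (yCode_injective h4) (Units.ext (congrFun h2 0))

variable [IsAlgClosed k]

theorem mat_comp (p q : Arrow D) (h : p.tgt = q.src) :
    S.mat (S.comp p q h) = S.mat p * S.mat q := by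
  obtain ⟨y, y', a, hp⟩ := p
  obtain ⟨z, z', b, hq⟩ := q
  obtain rfl : y' = z := h
  have e1 := S.elt_smul hp
  have e2 := S.elt_smul hq
  have e3 : S.elt (hp.trans hq) = S.elt hq * S.elt hp := S.elt_eq _ (by rw [mul_smul, e1, e2])
  have e4 := S.cocycle_spec (S.elt hp) (S.elt hq) y
  rw [e1] at e4
  change scalar _ (S.cocycle (S.elt hp) (S.elt hq) y * a * b) * S.g (S.elt (hp.trans hq)) y =
    scalar _ a * S.g (S.elt hp) y * (scalar _ b * S.g (S.elt hq) y')
  calc _ = scalar _ a * (scalar _ b * (scalar _ (S.cocycle (S.elt hp) (S.elt hq) y) *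
        S.g (S.elt hq * S.elt hp) y)) := by
          rw [e3, ← mul_assoc, ← mul_assoc, ← map_mul, ← map_mul]
          congr 2
          rw [mul_assoc, mul_comm]
    _ = scalar _ a * (scalar _ b * S.g (S.elt hp) y * S.g (S.elt hq) y') := by
          rw [← e4, mul_assoc (scalar _ b)]
    _ = _ := by
          rw [Matrix.GeneralLinearGroup.scalar_commute b]
          simp only [mul_assoc]

theorem g_one (y : D.Y) : S.g 1 y = scalar (Fin D.n) (S.cocycle 1 1 y) := by
  have h := S.cocycle_spec 1 1 y
  rw [one_smul, mul_one] at h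
  exact mul_right_cancel h

theorem mat_one (y : D.Y) : S.mat (S.one y) = 1 := by
  change scalar _ (S.cocycle 1 1 y)⁻¹ * S.g (S.elt (S.one y).fibre) y = 1
  rw [S.elt_eq (S.one y).fibre (one_smul Γ y), g_one, ← map_mul, inv_mul_cancel, map_one]

theorem mat_inv (p : Arrow D) : S.mat p * S.mat (S.inv p) = 1 := by
  rw [← S.mat_comp p (S.inv p) rfl, ← S.mat_one p.src]
  have e1 : S.elt (S.inv p).fibre = (S.elt p.fibre)⁻¹ :=
    S.elt_eq _ (by rw [inv_smul_eq_iff]; exact (S.elt_smul p.fibre).symm)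
  congr 1
  refine Arrow.ext rfl rfl ?_
  change S.cocycle (S.elt p.fibre) (S.elt (S.inv p).fibre) p.src * p.scal *
    (S.cocycle (S.elt p.fibre) (S.elt p.fibre)⁻¹ p.src * S.cocycle 1 1 p.src * p.scal)⁻¹ =
      (S.cocycle 1 1 p.src)⁻¹
  rw [e1]
  simp only [mul_inv_rev]
  rw [mul_assoc, mul_inv_cancel_left, mul_left_comm, mul_inv_cancel, mul_one]

/-- The splitting groupoid: objects `Y`, arrows `(Y ×_X Y) × kˣ`, composition twisted by the
2-cocycle; its groupoid quotient is `X ⊆ k ^ m`. -/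
noncomputable def splittingGroupoid : TupleGroupoid k where
  Obj := D.Y
  Arr := Arrow D
  src := Arrow.src
  tgt := Arrow.tgt
  one := S.one
  inv := S.inv
  comp := S.comp
  src_one _ := rfl
  tgt_one _ := rfl
  src_inv _ := rfl
  tgt_inv _ := rfl
  src_comp _ _ _ := rfl
  tgt_comp _ _ _ := rfl
  one_comp p := S.arrow_ext rfl rfl ((S.mat_comp _ _ _).trans (by rw [mat_one, one_mul]))
  comp_one p := S.arrow_ext rfl rfl ((S.mat_comp _ _ _).trans (by rw [mat_one, mul_one]))
  comp_assoc p q r _ _ := S.arrow_ext rfl rfl (by simp only [mat_comp, mul_assoc])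
  comp_inv p := S.arrow_ext rfl rfl ((S.mat_comp _ _ _).trans (by rw [mat_inv, mat_one]))
  inv_comp p := S.arrow_ext rfl rfl
    ((S.mat_comp _ _ _).trans (by rw [mat_one]; exact mul_eq_one_comm.1 (S.mat_inv p)))
  objDim := D.m + D.d * (D.n * D.n)
  arrDim := D.m + D.d * (D.n * D.n) + (D.m + D.d * (D.n * D.n)) + 1
  quotDim := D.m
  objCode := yCode
  arrCode := arrCode
  quotCode y := D.xCode y.x
  objCode_injective := yCode_injective
  arrCode_injective := arrCode_injective
  quotCode_eq_iff y y' :=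
    ⟨fun h => ⟨⟨y, y', 1, xCode_injective h⟩, rfl, rfl⟩, by rintro ⟨p, rfl, rfl⟩; rw [p.fibre]⟩

end QZGCover

/-! ### The geometry as a two-sorted structure -/

/-- A quantum Zariski geometry for the given data, as a family of `k`-vector spaces `V_x`, `x ∈ X`,
with linear operators `u_1, …, u_d` on every `V_x`, such that for every solution `t` of the equations
`f_l (t, x) = 0` there is a basis of `V_x` in which the operators act by the matrices `t`. -/
structure QZGeometry {k : Type u} {A : Type v} [Field k] [Ring A] [Algebra k A]
    (D : QZGData.{u, v, w} k A) where
  V : D.X → Type w₁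
  [addCommGroupV : ∀ x, AddCommGroup (V x)]
  [moduleV : ∀ x, Module k (V x)]
  op : Fin D.d → ∀ x, V x →ₗ[k] V x
  exists_basis : ∀ y : D.Y, ∃ b : Module.Basis (Fin D.n) k (V y.x),
    ∀ l j, op l y.x (b j) = ∑ i, y.t l i j • b i

attribute [instance] QZGeometry.addCommGroupV QZGeometry.moduleV

/-- Basic relations of a quantum Zariski geometry. -/
inductive GeomRel (m d : ℕ) : ℕ → Type
  | isField : GeomRel m d 1
  | add : GeomRel m d 3
  | mul : GeomRel m d 3
  | proj : GeomRel m d (m + 1)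
  | vadd : GeomRel m d 3
  | smul : GeomRel m d 3
  | op : Fin d → GeomRel m d 2

/-- The language of quantum Zariski geometries. -/
def geomLang (m d : ℕ) : Language := ⟨fun _ => Empty, GeomRel m d⟩

namespace QZGeometry

variable {k : Type u} {A : Type v} [Field k] [Ring A] [Algebra k A] {D : QZGData.{u, v, w} k A}

/-- The universe of the geometry: the disjoint union of the two sorts, the field `k` and the total
space `V` of the family `V_x`. -/
def Carrier (G : QZGeometry.{u, v, w, w₁} D) : Type (max u v w₁) := k ⊕ (Σ x : D.X, G.V x)

/-- The field sort. -/
def ofField (G : QZGeometry.{u, v, w, w₁} D) : k → G.Carrier := Sum.inl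

/-- The sort `V`. -/
def ofVec (G : QZGeometry.{u, v, w, w₁} D) {x : D.X} (a : G.V x) : G.Carrier := Sum.inr ⟨x, a⟩

/-- The two-sorted structure: the field `k`, the projection `V → X ⊆ k ^ m`, the graphs of addition
and of multiplication by scalars in the fibres, and the graphs of the operators. -/
instance geomStructure (G : QZGeometry.{u, v, w, w₁} D) :
    (geomLang D.m D.d).Structure G.Carrier where
  funMap := fun f => f.elim
  RelMap := fun {j} (R : GeomRel D.m D.d j) => match j, R with
    | _, .isField => fun v => ∃ a : k, v 0 = G.ofField a
    | _, .add => fun v => ∃ a b : k, v = ![G.ofField a, G.ofField b, G.ofField (a + b)]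
    | _, .mul => fun v => ∃ a b : k, v = ![G.ofField a, G.ofField b, G.ofField (a * b)]
    | _, .proj => fun v => ∃ (x : D.X) (a : G.V x),
        v = Fin.cons (G.ofVec a) fun i => G.ofField (D.xCode x i)
    | _, .vadd => fun v => ∃ (x : D.X) (a b : G.V x), v = ![G.ofVec a, G.ofVec b, G.ofVec (a + b)]
    | _, .smul => fun v => ∃ (c : k) (x : D.X) (a : G.V x),
        v = ![G.ofField c, G.ofVec a, G.ofVec (c • a)]
    | _, .op l => fun v => ∃ (x : D.X) (a : G.V x), v = ![G.ofVec a, G.ofVec (G.op l x a)]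

end QZGeometry

/-! An arrow from `y` to `γ • y` with scalar `a` carries the invertible matrix `a g_γ(y)`. The
cocycle in the composition law is exactly what makes `S.mat` turn composition into matrix
multiplication. An arrow is determined by its ends and its matrix, and the matrix intertwines the
matrices `t` at the two ends. The splitting groupoid is thus a groupoid of changes of basis, and a
torsor is, up to isomorphism, the family of all bases of the fibres `V_x` in which the operators act
by the matrices of a point of `Y`.

The link is a `Frame`: a coordinate system `k^n → V_x` for each point `p` of the torsor, such that
moving `p` along an arrow changes coordinates by the matrix of the arrow. It exists for every torsor
and every geometry (`exists_frame`): choose one point of the torsor and one adapted basis in each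
fibre, and transport them along arrows. These choices need not be definable. This does no harm,
since only the relations that the frame induces have to be definable, and those are expressible
without it.

From the torsor to the geometry: `V` is the quotient of `P × k^n` by the relation "same vector". By
`Frame.vec_eq_iff` this relation says that some arrow takes `p` to `q` and its matrix takes the
coordinates at `q` to those at `p`. The linear structure and the operators are computed in
coordinates.

From the geometry to the torsor: sending `p` to its anchor and its basis is injective. By Schur's
lemma (`QZGData.schur`) the image consists of all `(y, b)` where `b` lies in the fibre under `y`, is
not identically zero, and satisfies the equations prescribed by `y`. Such a `b` is a scalar multiple
of a basis of the frame, and every non-zero scalar is the matrix of an arrow from `y` to itself. So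
`P` is a definable subset of `Y × V^n` (`Frame.exists_emb_eq_iff`), and the action is read off from
the change of basis.

Both directions are proved inside an arbitrary structure in which `k` is a definable field. The pure
field, the geometry and the generalised imaginary sort are then special cases, and elimination is
the case of a torsor that is a definable subset of a power of `k`. -/

open scoped Matrix

/-! ## Imaginary sorts and definable maps between them -/

/-- A presentation of the set `E` as an imaginary sort of the structure `M`: the elements of `E` are
represented by tuples from `M`, so that it is definable whether two tuples represent the same
element. -/
class ImagSort (L : Language) (M : Type*) [L.Structure M] (E : Type*) where
  ι : Type
  finite_ι : Finite ι
  rep : (ι → M) → E → Prop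
  rep_unique : ∀ {v e e'}, rep v e → rep v e' → e = e'
  exists_rep : ∀ e, ∃ v, rep v e
  eq_definable : (Set.univ : Set M).Definable L
    {v : ι ⊕ ι → M | ∃ e, rep (v ∘ Sum.inl) e ∧ rep (v ∘ Sum.inr) e}

attribute [instance] ImagSort.finite_ι

section ImagSort

variable (L : Language) (M : Type*) [L.Structure M]
variable {E F H : Type*} [ImagSort L M E] [ImagSort L M F] [ImagSort L M H]

open ImagSort

variable {M} in
/-- The tuple `v` represents the element `e` of an imaginary sort. -/
abbrev Codes (v : ι L M E → M) (e : E) : Prop := ImagSort.rep v e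

/-- A predicate on an imaginary sort is definable, with parameters. -/
def Def (S : E → Prop) : Prop :=
  (Set.univ : Set M).Definable L {v : ι L M E → M | ∃ e, Codes L v e ∧ S e}

variable {L M}

/-! ### Definable predicates on imaginary sorts: Boolean operations and quantifiers. -/

theorem Set.Definable.congr {α : Type*} {s t : Set (α → M)} (hs : (Set.univ : Set M).Definable L s)
    (h : ∀ v, v ∈ t ↔ v ∈ s) : (Set.univ : Set M).Definable L t := by
  rwa [Set.ext h]

theorem Def.congr {S S' : E → Prop} (hS : Def L M S) (h : ∀ e, S' e ↔ S e) : Def L M S' := by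
  rwa [show S' = S from funext fun e => propext (h e)]

-- A tuple represents something exactly when it represents the same thing as itself, so the set of
-- codes is the diagonal part of `eq_definable`. It serves as the universe relative to which
-- complements are taken.
variable (L M E) in
theorem Def.true : Def L M fun _ : E => True := by
  refine (Set.Definable.preimage_comp (Sum.elim id id)
    (eq_definable (L := L) (M := M) (E := E))).congr fun v => ?_
  simp only [and_true, Set.mem_ofPred_eq, Set.mem_preimage]
  exact exists_congr fun e => (and_self_iff).symm

theorem Def.and {S S' : E → Prop} (h : Def L M S) (h' : Def L M S') :
    Def L M fun e => S e ∧ S' e := by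
  refine (Set.Definable.inter h h').congr fun v => ⟨?_, ?_⟩
  · rintro ⟨e, he, h1, h2⟩
    exact ⟨⟨e, he, h1⟩, ⟨e, he, h2⟩⟩
  · rintro ⟨⟨e, he, h1⟩, ⟨e', he', h2⟩⟩
    obtain rfl := rep_unique he he'
    exact ⟨e, he, h1, h2⟩

theorem Def.not {S : E → Prop} (h : Def L M S) : Def L M fun e => ¬ S e := by
  refine (Set.Definable.sdiff (Def.true L M E) h).congr fun v => ⟨?_, ?_⟩
  · rintro ⟨e, he, h1⟩
    refine ⟨⟨e, he, trivial⟩, ?_⟩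
    rintro ⟨e', he', h2⟩
    exact h1 (rep_unique he he' ▸ h2)
  · rintro ⟨⟨e, he, -⟩, h1⟩
    exact ⟨e, he, fun h2 => h1 ⟨e, he, h2⟩⟩

theorem Def.forall_finite {α : Type*} [Finite α] {S : α → E → Prop} (h : ∀ i, Def L M (S i)) :
    Def L M fun e => ∀ i, S i e := by
  -- When `α` is empty the intersection is the whole power of `M`, so tuples that represent nothing
  -- have to be removed separately.
  refine (Set.Definable.inter (Def.true L M E) (Set.definable_iInter_of_finite h)).congr
    fun v => ⟨?_, ?_⟩
  · rintro ⟨e, he, h1⟩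
    exact ⟨⟨e, he, trivial⟩, Set.mem_iInter.2 fun i => ⟨e, he, h1 i⟩⟩
  · rintro ⟨⟨e, he, -⟩, h1⟩
    refine ⟨e, he, fun i => ?_⟩
    obtain ⟨e', he', h2⟩ := Set.mem_iInter.1 h1 i
    exact rep_unique he he' ▸ h2

theorem Def.exists_finite {α : Type*} [Finite α] {S : α → E → Prop} (h : ∀ i, Def L M (S i)) :
    Def L M fun e => ∃ i, S i e :=
  (Def.forall_finite fun i => (h i).not).not.congr fun e => by push Not; rfl

/-- Pulling back along a map that only selects and rearranges coordinates. -/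
theorem Def.reindex {S : E → Prop} (h : Def L M S) (f : F → E) (j : ι L M E → ι L M F)
    (hj : ∀ v e, Codes L v e → Codes L (v ∘ j) (f e)) : Def L M fun e => S (f e) := by
  refine (Set.Definable.inter (Def.true L M F) (h.preimage_comp j)).congr fun v => ⟨?_, ?_⟩
  · rintro ⟨e, he, h1⟩
    exact ⟨⟨e, he, trivial⟩, ⟨f e, hj v e he, h1⟩⟩
  · rintro ⟨⟨e, he, -⟩, ⟨e', he', h1⟩⟩
    exact ⟨e, he, show S (f e) by rwa [rep_unique (hj v e he) he']⟩

instance ImagSort.prod : ImagSort L M (E × F) where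
  ι := ι L M E ⊕ ι L M F
  finite_ι := inferInstance
  rep v p := Codes L (v ∘ Sum.inl) p.1 ∧ Codes L (v ∘ Sum.inr) p.2
  rep_unique h h' := Prod.ext (rep_unique h.1 h'.1) (rep_unique h.2 h'.2)
  exists_rep p := by
    obtain ⟨v, hv⟩ := exists_rep (L := L) (M := M) p.1
    obtain ⟨q, hq⟩ := exists_rep (L := L) (M := M) p.2
    exact ⟨Sum.elim v q, hv, hq⟩
  eq_definable := by
    refine (Set.Definable.inter
      ((eq_definable (L := L) (M := M) (E := E)).preimage_comp (Sum.map Sum.inl Sum.inl))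
      ((eq_definable (L := L) (M := M) (E := F)).preimage_comp (Sum.map Sum.inr Sum.inr))).congr
        fun v => ⟨?_, ?_⟩
    · rintro ⟨p, h, h'⟩
      exact ⟨⟨p.1, h.1, h'.1⟩, ⟨p.2, h.2, h'.2⟩⟩
    · rintro ⟨⟨e, h1, h2⟩, ⟨f, h3, h4⟩⟩
      exact ⟨(e, f), ⟨h1, h3⟩, ⟨h2, h4⟩⟩

/-- Quantifying over `F` is projection along the finitely many coordinates that code its elements;
this is faithful because every element has a code. -/
theorem Def.exists {S : E → F → Prop} (h : Def L M fun p : E × F => S p.1 p.2) :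
    Def L M fun e => ∃ f, S e f := by
  refine (Set.Definable.exists_of_finite h).congr fun v => ⟨?_, ?_⟩
  · rintro ⟨e, he, f, h1⟩
    obtain ⟨q, hq⟩ := exists_rep (L := L) (M := M) f
    exact ⟨q, (e, f), ⟨he, hq⟩, h1⟩
  · rintro ⟨q, p, hp, h1⟩
    exact ⟨p.1, hp.1, p.2, h1⟩

/-! ### Definable maps between imaginary sorts. -/

variable (L M) in
/-- A map between imaginary sorts is definable, with parameters. -/
@[fun_prop]
def DefMap (f : E → F) : Prop := Def L M fun p : E × F => f p.1 = p.2

variable (L M E) in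
theorem Def.diagonal : Def L M fun p : E × E => p.1 = p.2 := by
  refine (eq_definable (L := L) (M := M) (E := E)).congr fun v => ⟨?_, ?_⟩
  · rintro ⟨⟨e, e'⟩, he, h⟩
    obtain rfl : e = e' := h
    exact ⟨e, he⟩
  · rintro ⟨e, he⟩
    exact ⟨(e, e), he, rfl⟩

theorem DefMap.of_reindex (f : F → E) (j : ι L M E → ι L M F)
    (hj : ∀ v e, Codes L v e → Codes L (v ∘ j) (f e)) : DefMap L M f :=
  (Def.diagonal L M E).reindex (fun p : F × E => (f p.1, p.2)) (Sum.map j id)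
    fun _ _ h => ⟨hj _ _ h.1, h.2⟩

/-- The value of `f` is introduced by an existential quantifier over the graph. -/
theorem Def.comp {S : F → Prop} {f : E → F} (h : Def L M S) (hf : DefMap L M f) :
    Def L M fun e => S (f e) :=
  (Def.exists (S := fun e y => f e = y ∧ S y)
    (Def.and hf (h.reindex (fun p : E × F => p.2) Sum.inr fun _ _ h => h.2))).congr
    fun e => by simp

@[fun_prop]
theorem DefMap.id : DefMap L M fun e : E => e := DefMap.of_reindex _ (fun i => i) fun _ _ h => h

@[fun_prop]
theorem DefMap.comp {g : F → H} {f : E → F} (hg : DefMap L M g) (hf : DefMap L M f) :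
    DefMap L M fun e => g (f e) :=
  (Def.exists (S := fun (p : E × H) y => f p.1 = y ∧ g y = p.2) (Def.and
    (Def.reindex hf (fun p : (E × H) × F => (p.1.1, p.2)) (Sum.map Sum.inl _root_.id)
      fun _ _ h => ⟨h.1.1, h.2⟩)
    (Def.reindex hg (fun p : (E × H) × F => (p.2, p.1.2))
      (Sum.elim Sum.inr fun i => Sum.inl (Sum.inr i)) fun _ _ h => ⟨h.2, h.1.2⟩))).congr
    fun p => by simp

theorem DefMap.fst' : DefMap L M fun p : E × F => p.1 :=
  DefMap.of_reindex _ Sum.inl fun _ _ h => h.1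

theorem DefMap.snd' : DefMap L M fun p : E × F => p.2 :=
  DefMap.of_reindex _ Sum.inr fun _ _ h => h.2

@[fun_prop]
theorem DefMap.fst {f : E → F × H} (hf : DefMap L M f) : DefMap L M fun e => (f e).1 :=
  DefMap.fst'.comp hf

@[fun_prop]
theorem DefMap.snd {f : E → F × H} (hf : DefMap L M f) : DefMap L M fun e => (f e).2 :=
  DefMap.snd'.comp hf

@[fun_prop]
theorem DefMap.prodMk {f : E → F} {g : E → H} (hf : DefMap L M f) (hg : DefMap L M g) :
    DefMap L M fun e => (f e, g e) :=
  (Def.and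
    (Def.reindex hf (fun p : E × F × H => (p.1, p.2.1)) (Sum.map _root_.id Sum.inl)
      fun _ _ h => ⟨h.1, h.2.1⟩)
    (Def.reindex hg (fun p : E × F × H => (p.1, p.2.2)) (Sum.map _root_.id Sum.inr)
      fun _ _ h => ⟨h.1, h.2.2⟩)).congr fun _ => Prod.ext_iff

theorem Def.eq {f g : E → F} (hf : DefMap L M f) (hg : DefMap L M g) :
    Def L M fun e => f e = g e :=
  (Def.diagonal L M F).comp (hf.prodMk hg)

-- Parameters enter here: a code of `c` is substituted into one half of the equality relation of the
-- sort.
@[fun_prop]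
theorem DefMap.const (c : F) : DefMap L M fun _ : E => c := by
  obtain ⟨q, hq⟩ := exists_rep (L := L) (M := M) c
  have h : Def L M fun y : F => c = y := by
    refine (Set.Definable.inter (Def.true L M F)
      ((eq_definable (L := L) (M := M) (E := F)).preimage_map
        (F := fun v : ι L M F → M => Sum.elim q v) ?_)).congr fun v => ⟨?_, ?_⟩
    · rintro (i | i)
      · exact L.definableFun_const _ (Set.mem_univ _)
      · exact Set.DefinableFun.proj L
    · rintro ⟨e, he, rfl⟩
      exact ⟨⟨_, he, trivial⟩, ⟨_, hq, he⟩⟩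
    · rintro ⟨-, ⟨e, h1, h2⟩⟩
      exact ⟨e, h2, rep_unique hq h1⟩
  exact h.comp DefMap.snd'

/-- The graph of `f` is the locus where `g ∘ f` and `g` agree. This is how maps into a subsort are
shown definable. -/
theorem DefMap.of_comp_injective {f : E → F} {g : F → H} (hg : DefMap L M g)
    (hi : Function.Injective g) (h : DefMap L M fun e => g (f e)) : DefMap L M f :=
  (Def.eq (h.comp DefMap.fst') (hg.comp DefMap.snd')).congr fun _ => hi.eq_iff.symm

/-! ### Powers -/

instance ImagSort.pi {α : Type} [Finite α] : ImagSort L M (α → E) where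
  ι := α × ι L M E
  finite_ι := inferInstance
  rep v e := ∀ i, Codes L (fun c => v (i, c)) (e i)
  rep_unique h h' := funext fun i => rep_unique (h i) (h' i)
  exists_rep e := by
    choose q hq using fun i => exists_rep (L := L) (M := M) (e i)
    exact ⟨fun p => q p.1 p.2, hq⟩
  eq_definable := by
    refine (Set.definable_iInter_of_finite fun i : α =>
      ((eq_definable (L := L) (M := M) (E := E)).preimage_comp
        (Sum.map (Prod.mk i) (Prod.mk i)))).congr fun v => ⟨?_, ?_⟩
    · rintro ⟨e, h, h'⟩
      exact Set.mem_iInter.2 fun i => ⟨e i, h i, h' i⟩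
    · intro h
      choose e h1 h2 using Set.mem_iInter.1 h
      exact ⟨e, h1, h2⟩

@[fun_prop]
theorem DefMap.eval {α : Type} [Finite α] (i : α) : DefMap L M fun e : α → E => e i :=
  DefMap.of_reindex _ (Prod.mk i) fun _ _ h => h i

theorem DefMap.apply {α : Type} [Finite α] {f : F → α → E} (hf : DefMap L M f) (i : α) :
    DefMap L M fun e => f e i :=
  (DefMap.eval i).comp hf

@[fun_prop]
theorem DefMap.pi {α : Type} [Finite α] {f : F → α → E} (h : ∀ i, DefMap L M fun e => f e i) :
    DefMap L M f :=
  (Def.forall_finite fun i => Def.eq ((h i).comp DefMap.fst')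
    ((DefMap.eval i).comp DefMap.snd')).congr fun _ => funext_iff

@[fun_prop]
theorem DefMap.finCons {n : ℕ} {f : F → E} {g : F → Fin n → E} (hf : DefMap L M f)
    (hg : DefMap L M g) : DefMap L M fun e => (Fin.cons (f e) (g e) : Fin (n + 1) → E) :=
  DefMap.pi fun i => Fin.cases hf (fun i => hg.apply i) i

@[fun_prop]
theorem DefMap.vecCons {n : ℕ} {f : F → E} {g : F → Fin n → E} (hf : DefMap L M f)
    (hg : DefMap L M g) : DefMap L M fun e => Matrix.vecCons (f e) (g e) :=
  hf.finCons hg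

@[fun_prop]
theorem DefMap.sumElim {α β : Type} [Finite α] [Finite β] {f : F → α → E} {g : F → β → E}
    (hf : DefMap L M f) (hg : DefMap L M g) : DefMap L M fun e => Sum.elim (f e) (g e) :=
  DefMap.pi fun i => by
    rcases i with i | i
    exacts [hf.apply i, hg.apply i]

@[fun_prop]
theorem DefMap.finAppend {m n : ℕ} {f : F → Fin m → E} {g : F → Fin n → E}
    (hf : DefMap L M f) (hg : DefMap L M g) : DefMap L M fun e => Fin.append (f e) (g e) :=
  DefMap.pi fun i => by
    induction i using Fin.addCases with
    | left i => simpa using hf.apply i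
    | right i => simpa using hg.apply i

/-! ### Disjoint unions -/

/-- One extra coordinate holds one of two fixed distinct elements of `M`, as a tag for the summand.
The block of coordinates belonging to the other summand is unconstrained, so codes are far from
unique. -/
noncomputable instance ImagSort.sum [Nontrivial M] : ImagSort L M (E ⊕ F) where
  ι := Option (ι L M E ⊕ ι L M F)
  finite_ι := inferInstance
  rep v := Sum.elim
    (fun e => v none = (exists_pair_ne M).choose ∧ Codes L (v ∘ some ∘ Sum.inl) e)
    (fun f => v none = (exists_pair_ne M).choose_spec.choose ∧ Codes L (v ∘ some ∘ Sum.inr) f)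
  rep_unique {v x x'} h h' := by
    have hne := (exists_pair_ne M).choose_spec.choose_spec
    rcases x with e | f <;> rcases x' with e' | f'
    · exact congrArg _ (rep_unique h.2 h'.2)
    · exact absurd (h.1.symm.trans h'.1) hne
    · exact absurd (h'.1.symm.trans h.1) hne
    · exact congrArg _ (rep_unique h.2 h'.2)
  exists_rep := by
    rintro (e | f)
    · obtain ⟨v, hv⟩ := exists_rep (L := L) (M := M) e
      exact ⟨fun o => o.elim (exists_pair_ne M).choose
        (Sum.elim v fun _ => (exists_pair_ne M).choose), rfl, hv⟩
    · obtain ⟨v, hv⟩ := exists_rep (L := L) (M := M) f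
      exact ⟨fun o => o.elim (exists_pair_ne M).choose_spec.choose
        (Sum.elim (fun _ => (exists_pair_ne M).choose) v), rfl, hv⟩
  eq_definable := by
    have hc : ∀ (a : M) (i : Option (ι L M E ⊕ ι L M F) ⊕ Option (ι L M E ⊕ ι L M F)),
        (Set.univ : Set M).Definable L
          {v : Option (ι L M E ⊕ ι L M F) ⊕ Option (ι L M E ⊕ ι L M F) → M | v i = a} :=
      fun a i => (Set.DefinableFun.proj L).ofPred_eq_const (Set.mem_univ a)
    refine (Set.Definable.union
      (((hc (exists_pair_ne M).choose (Sum.inl none)).inter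
        (hc (exists_pair_ne M).choose (Sum.inr none))).inter
        ((eq_definable (L := L) (M := M) (E := E)).preimage_comp
          (Sum.map (some ∘ Sum.inl) (some ∘ Sum.inl))))
      (((hc (exists_pair_ne M).choose_spec.choose (Sum.inl none)).inter
        (hc (exists_pair_ne M).choose_spec.choose (Sum.inr none))).inter
        ((eq_definable (L := L) (M := M) (E := F)).preimage_comp
          (Sum.map (some ∘ Sum.inr) (some ∘ Sum.inr))))).congr fun v => ⟨?_, ?_⟩
    · rintro ⟨e | f, h, h'⟩
      · exact Or.inl ⟨⟨h.1, h'.1⟩, ⟨e, h.2, h'.2⟩⟩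
      · exact Or.inr ⟨⟨h.1, h'.1⟩, ⟨f, h.2, h'.2⟩⟩
    · rintro (⟨⟨h1, h2⟩, ⟨e, h3, h4⟩⟩ | ⟨⟨h1, h2⟩, ⟨f, h3, h4⟩⟩)
      · exact ⟨Sum.inl e, ⟨h1, h3⟩, ⟨h2, h4⟩⟩
      · exact ⟨Sum.inr f, ⟨h1, h3⟩, ⟨h2, h4⟩⟩

theorem DefMap.inl [Nontrivial M] : DefMap L M (Sum.inl : E → E ⊕ F) := by
  refine (Set.Definable.inter
    ((Set.DefinableFun.proj L (i := Sum.inr none)).ofPred_eq_const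
      (Set.mem_univ (exists_pair_ne M).choose))
    ((eq_definable (L := L) (M := M) (E := E)).preimage_comp
      (Sum.map _root_.id (some ∘ Sum.inl)))).congr fun v => ⟨?_, ?_⟩
  · rintro ⟨⟨e, s⟩, h, hs⟩
    obtain rfl : Sum.inl e = s := hs
    exact ⟨h.2.1, ⟨e, h.1, h.2.2⟩⟩
  · rintro ⟨h1, ⟨e, h2, h3⟩⟩
    exact ⟨(e, Sum.inl e), ⟨h2, h1, h3⟩, rfl⟩

theorem DefMap.inr [Nontrivial M] : DefMap L M (Sum.inr : F → E ⊕ F) := by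
  refine (Set.Definable.inter
    ((Set.DefinableFun.proj L (i := Sum.inr none)).ofPred_eq_const
      (Set.mem_univ (exists_pair_ne M).choose_spec.choose))
    ((eq_definable (L := L) (M := M) (E := F)).preimage_comp
      (Sum.map _root_.id (some ∘ Sum.inr)))).congr fun v => ⟨?_, ?_⟩
  · rintro ⟨⟨e, s⟩, h, hs⟩
    obtain rfl : Sum.inr e = s := hs
    exact ⟨h.2.1, ⟨e, h.1, h.2.2⟩⟩
  · rintro ⟨h1, ⟨e, h2, h3⟩⟩
    exact ⟨(e, Sum.inr e), ⟨h2, h1, h3⟩, rfl⟩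

/-! ### The home sort, subsorts and quotients -/

instance ImagSort.self : ImagSort L M M where
  ι := Unit
  finite_ι := inferInstance
  rep v a := v () = a
  rep_unique h h' := h.symm.trans h'
  exists_rep a := ⟨fun _ => a, rfl⟩
  eq_definable := by
    refine ((Set.DefinableFun.proj L (i := Sum.inl ())).ofPred_eq
      (Set.DefinableFun.proj L (i := Sum.inr ()))).congr fun v => ⟨?_, fun h => ⟨_, h, rfl⟩⟩
    rintro ⟨a, h, h'⟩
    exact h.trans h'.symm

/-- Tuples from the home sort code themselves, up to the index type `α × Unit` of the power. This
connects the calculus of imaginary sorts with definable sets. -/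
theorem def_iff_definable {α : Type} [Finite α] {S : Set (α → M)} :
    Def L M (fun v => v ∈ S) ↔ (Set.univ : Set M).Definable L S := by
  constructor <;> intro h
  · refine (h.preimage_comp (fun p : α × Unit => p.1)).congr fun v =>
      ⟨fun hv => ⟨v, fun _ => rfl, hv⟩, ?_⟩
    rintro ⟨e, he, h1⟩
    rwa [show v = e from funext he]
  · refine (h.preimage_comp (fun i : α => (i, ()))).congr fun v =>
      ⟨?_, fun hv => ⟨_, fun _ => rfl, hv⟩⟩
    rintro ⟨e, he, h1⟩
    rwa [Set.mem_preimage, show v ∘ (fun i : α => (i, ())) = e from funext he]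

theorem Def.relMap {j : ℕ} (R : L.Relations j) :
    Def L M fun v : Fin j → M => Language.Structure.RelMap R v := by
  refine (def_iff_definable (S := {v | Language.Structure.RelMap R v})).2 (Set.Definable.mono
    (Set.empty_definable_iff.2 ⟨R.formula Language.Term.var, ?_⟩) (Set.empty_subset _))
  ext v
  simp

/-- A subset of an imaginary sort, given by an injective map with definable range. -/
@[reducible]
def ImagSort.ofInjective {E F : Type*} [ImagSort L M F] (f : E → F) (hf : Function.Injective f)
    (h : Def L M fun y => ∃ e, f e = y) : ImagSort L M E where
  ι := ι L M F
  finite_ι := inferInstance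
  rep v e := Codes L v (f e)
  rep_unique h h' := hf (rep_unique h h')
  exists_rep e := exists_rep (f e)
  eq_definable := by
    refine (Set.Definable.inter (eq_definable (L := L) (M := M) (E := F))
      (h.preimage_comp Sum.inl)).congr fun v => ⟨?_, ?_⟩
    · rintro ⟨e, h1, h2⟩
      exact ⟨⟨_, h1, h2⟩, ⟨_, h1, ⟨e, rfl⟩⟩⟩
    · rintro ⟨⟨y, h1, h2⟩, ⟨_, h3, ⟨e, rfl⟩⟩⟩
      obtain rfl := rep_unique h1 h3
      exact ⟨e, h1, h2⟩

theorem DefMap.ofInjective {E F : Type*} [ImagSort L M F] (f : E → F) (hf : Function.Injective f)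
    (h : Def L M fun y => ∃ e, f e = y) :
    let _ := ImagSort.ofInjective f hf h
    DefMap L M f :=
  let _ := ImagSort.ofInjective f hf h
  DefMap.of_reindex f (fun i => i) fun _ _ h => h

/-- A quotient of an imaginary sort by a definable equivalence relation. -/
@[reducible]
def ImagSort.ofSurjective {E F : Type*} [ImagSort L M E] (f : E → F) (hf : Function.Surjective f)
    (h : Def L M fun p : E × E => f p.1 = f p.2) : ImagSort L M F where
  ι := ι L M E
  finite_ι := inferInstance
  rep v y := ∃ e, Codes L v e ∧ f e = y
  rep_unique := by
    rintro v _ _ ⟨e, h, rfl⟩ ⟨e', h', rfl⟩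
    rw [rep_unique h h']
  exists_rep y := by
    obtain ⟨e, rfl⟩ := hf y
    obtain ⟨v, hv⟩ := exists_rep (L := L) (M := M) e
    exact ⟨v, e, hv, rfl⟩
  eq_definable := by
    refine Set.Definable.congr h fun v => ⟨?_, ?_⟩
    · rintro ⟨_, ⟨e, h1, rfl⟩, ⟨e', h2, h3⟩⟩
      exact ⟨(e, e'), ⟨h1, h2⟩, h3.symm⟩
    · rintro ⟨⟨e, e'⟩, ⟨h1, h2⟩, h3⟩
      exact ⟨f e, ⟨e, h1, rfl⟩, ⟨e', h2, h3.symm⟩⟩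

theorem DefMap.ofSurjective {E F : Type*} [ImagSort L M E] (f : E → F) (hf : Function.Surjective f)
    (h : Def L M fun p : E × E => f p.1 = f p.2) :
    let _ := ImagSort.ofSurjective f hf h
    DefMap L M f := by
  let _ := ImagSort.ofSurjective f hf h
  refine Set.Definable.congr h fun v => ⟨?_, ?_⟩
  · rintro ⟨⟨e, y⟩, ⟨h1, ⟨e', h2, h3⟩⟩, h⟩
    obtain rfl : f e = y := h
    exact ⟨(e, e'), ⟨h1, h2⟩, h3.symm⟩
  · rintro ⟨⟨e, e'⟩, ⟨h1, h2⟩, h3⟩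
    exact ⟨(e, f e), ⟨h1, ⟨e', h2, h3.symm⟩⟩, rfl⟩

/-! ### Interpretations from imaginary sorts -/

/-- A structure on an imaginary sort all of whose basic relations and functions are definable is
interpretable; it is so over a common sort `K` if the correspondence of the copies is definable. -/
theorem interpretableOver_of_imagSort {L' : Language} {N : Type*} [L'.Structure N] [ImagSort L M N]
    (hR : ∀ {j : ℕ} (R : L'.Relations j),
      Def L M fun x : Fin j → N => Language.Structure.RelMap R x)
    (hF : ∀ {j : ℕ} (f : L'.Functions j),
      Def L M fun x : Fin (j + 1) → N =>
        Language.Structure.funMap f (fun i => x i.castSucc) = x (Fin.last j))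
    {K : Type*} (a : K → M) (b : K → N)
    (hK : Def L M fun p : M × N => ∃ c, p.1 = a c ∧ p.2 = b c) :
    InterpretableOver L M L' N a b := by
  let n := Nat.card (ι L M N)
  let ε : ι L M N ≃ Fin n := Finite.equivFin _
  let dom : Set (Fin n → M) := {q | ∃ e : N, Codes L (q ∘ ε) e}
  -- The choice is harmless, since a tuple represents at most one element.
  let map : dom → N := fun q => q.2.choose
  have hmap : ∀ q : dom, Codes L (q.1 ∘ ε) (map q) := fun q => q.2.choose_spec
  have map_eq : ∀ (q : dom) (e : N), Codes L (q.1 ∘ ε) e → map q = e :=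
    fun q e he => rep_unique (hmap q) he
  -- The definability conditions for equality, relations and functions in an interpretation all have
  -- this shape, with different `S`.
  have key : ∀ {j : ℕ} {S : (Fin j → N) → Prop}, Def L M S → (Set.univ : Set M).Definable L
      {v : Fin j × Fin n → M | ∃ q : Fin j → dom, (∀ i c, v (i, c) = (q i).1 c) ∧
        S fun i => map (q i)} := by
    intro j S hS
    refine (hS.preimage_comp (Prod.map _root_.id ε)).congr fun v => ⟨?_, ?_⟩
    · rintro ⟨q, h1, h2⟩
      refine ⟨_, fun i => ?_, h2⟩
      convert hmap (q i) using 1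
      ext c
      exact h1 i (ε c)
    · rintro ⟨e, he, h2⟩
      have he' : ∀ i, Codes L ((fun c => v (i, c)) ∘ ε) (e i) := he
      refine ⟨fun i => ⟨fun c => v (i, c), ⟨e i, he' i⟩⟩, fun _ _ => rfl, ?_⟩
      convert h2 with i
      exact map_eq _ _ (he' i)
  refine ⟨⟨n, dom, map, ?_, ?_, ?_, fun R => key (hR R), fun f => key (hF f)⟩, ?_⟩
  · intro e
    obtain ⟨v, hv⟩ := exists_rep (L := L) (M := M) e
    have hv' : Codes L ((v ∘ ε.symm) ∘ ε) e := by
      rwa [Function.comp_assoc, ε.symm_comp_self, Function.comp_id]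
    exact ⟨⟨v ∘ ε.symm, e, hv'⟩, map_eq _ _ hv'⟩
  · exact ((Def.true L M N).preimage_comp ε).congr fun v => by simp [dom]
  · exact key (Def.eq (DefMap.eval 0) (DefMap.eval 1))
  · refine (hK.preimage_comp (Sum.elim (fun _ => none) fun i => some (ε i))).congr
      fun v => ⟨?_, ?_⟩
    · rintro ⟨c, q, h1, h2, h3⟩
      refine ⟨(a c, b c), ⟨h1, ?_⟩, ⟨c, rfl, rfl⟩⟩
      convert hmap q using 1
      · ext i
        exact h2 (ε i)
      · exact h3.symm
    · rintro ⟨⟨_, _⟩, ⟨h1, h2⟩, ⟨c, rfl, rfl⟩⟩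
      exact ⟨c, ⟨fun i => v (some i), ⟨_, h2⟩⟩, h1, fun _ => rfl, map_eq _ _ h2⟩

end ImagSort

/-! ## Sorts carrying a definable field structure -/

section DefField

variable (L : Language) (M : Type*) [L.Structure M]

/-- The field operations on an imaginary sort are definable. -/
class DefField (k : Type*) [Field k] [ImagSort L M k] : Prop where
  add : DefMap L M fun p : k × k => p.1 + p.2
  mul : DefMap L M fun p : k × k => p.1 * p.2

variable {L M} {k : Type*} [Field k] [ImagSort L M k] [DefField L M k] {E : Type*} [ImagSort L M E]

@[fun_prop]
theorem DefMap.add {f g : E → k} (hf : DefMap L M f) (hg : DefMap L M g) :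
    DefMap L M fun e => f e + g e :=
  DefMap.comp DefField.add (hf.prodMk hg)

@[fun_prop]
theorem DefMap.mul {f g : E → k} (hf : DefMap L M f) (hg : DefMap L M g) :
    DefMap L M fun e => f e * g e :=
  DefMap.comp DefField.mul (hf.prodMk hg)

@[fun_prop]
theorem DefMap.finsetSum {α : Type*} (s : Finset α) {f : α → E → k} (h : ∀ i, DefMap L M (f i)) :
    DefMap L M fun e => ∑ i ∈ s, f i e := by
  classical
  induction s using Finset.induction_on with
  | empty => simpa using DefMap.const (0 : k)
  | insert i s hi ih => simpa only [Finset.sum_insert hi] using (h i).add ih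

@[fun_prop]
theorem DefMap.mvPolynomialEval {σ : Type} [Finite σ] (q : MvPolynomial σ k) {f : E → σ → k}
    (hf : DefMap L M f) : DefMap L M fun e => MvPolynomial.eval (f e) q := by
  induction q using MvPolynomial.induction_on with
  | C a => simpa using DefMap.const a
  | add q q' h h' => simpa using h.add h'
  | mul_X q i h => simpa using h.mul (hf.apply i)

end DefField

/-! ## The splitting groupoid in imaginary sorts -/

namespace QZGData

variable {k : Type u} {A : Type v} [Field k] [Ring A] [Algebra k A] {D : QZGData.{u, v, w} k A}

/-- The set of points of `X` is cut out by finitely many polynomials. -/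
theorem exists_equations_X (D : QZGData.{u, v, w} k A) :
    ∃ s : Finset (MvPolynomial (Fin D.m) k), ∀ a : Fin D.m → k,
      (∃ x : D.X, D.xCode x = a) ↔ ∀ q : s, MvPolynomial.eval a q.1 = 0 := by
  let φ := MvPolynomial.aeval (R := k) D.z
  have hφ : Function.Surjective φ := by
    rw [← AlgHom.range_eq_top, ← Algebra.adjoin_range_eq_range_aeval, D.adjoin_z]
  -- Hilbert's basis theorem: the relations between the coordinate functions form a finitely
  -- generated ideal.
  obtain ⟨s, hs⟩ := (inferInstance : IsNoetherianRing (MvPolynomial (Fin D.m) k)).noetherian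
    (RingHom.ker φ)
  refine ⟨s, fun a => ⟨?_, fun h => ?_⟩⟩
  · rintro ⟨x, rfl⟩ ⟨q, hq⟩
    have h1 : q ∈ RingHom.ker φ := hs ▸ Submodule.subset_span hq
    have h2 : x.comp φ = MvPolynomial.aeval (D.xCode x) := by
      ext i
      simp [φ, xCode]
    rw [← MvPolynomial.coe_aeval_eq_eval]
    change MvPolynomial.aeval (D.xCode x) q = 0
    rw [← h2, AlgHom.comp_apply, (RingHom.mem_ker).1 h1, map_zero]
  · have h1 : RingHom.ker φ ≤ RingHom.ker (MvPolynomial.aeval (R := k) a) := by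
      rw [← hs]
      refine Submodule.span_le.2 fun q hq => ?_
      exact h ⟨q, hq⟩
    -- Evaluation at `a` kills all relations, so it descends to the polynomial ring modulo `ker φ`,
    -- which is the centre.
    let x : D.X := (Ideal.Quotient.liftₐ (RingHom.ker φ) (MvPolynomial.aeval (R := k) a) h1).comp
      (Ideal.quotientKerAlgEquivOfSurjective hφ).symm.toAlgHom
    refine ⟨x, funext fun i => ?_⟩
    have h2 : (Ideal.quotientKerAlgEquivOfSurjective hφ).symm (D.z i) =
        Ideal.Quotient.mk _ (MvPolynomial.X i) := by
      rw [AlgEquiv.symm_apply_eq]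
      simp [φ]
    change Ideal.Quotient.liftₐ (RingHom.ker φ) _ h1
      ((Ideal.quotientKerAlgEquivOfSurjective hφ).symm (D.z i)) = a i
    rw [h2]
    exact MvPolynomial.aeval_X a i

theorem coords_injective : Function.Injective (Y.coords (D := D)) := by
  intro y y' h
  refine Subtype.ext (Prod.ext (QZGCover.xCode_injective ?_) ?_)
  · funext i
    exact congrFun h (Sum.inl i)
  · ext l i j
    exact congrFun h (Sum.inr (l, i, j))

variable {L : Language} {M : Type*} [L.Structure M] [ImagSort L M k] [DefField L M k]
variable {E : Type*} [ImagSort L M E]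

-- The equations of `X`, applied to the first block of coordinates, together with the equations
-- `f_l`, cut out `Y`.
variable (L M) in
theorem def_range_coords : Def L M fun a => ∃ y : D.Y, y.coords = a := by
  obtain ⟨s, hs⟩ := exists_equations_X D
  refine (Def.and
    (Def.forall_finite fun q : s => Def.eq (DefMap.mvPolynomialEval q.1
      (DefMap.pi fun i => DefMap.eval (Sum.inl i))) (DefMap.const 0))
    (Def.forall_finite fun l : Fin D.r => Def.eq (DefMap.mvPolynomialEval (D.f l) DefMap.id)
      (DefMap.const 0))).congr fun a => ?_
  rw [← hs]
  constructor
  · rintro ⟨y, rfl⟩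
    exact ⟨⟨y.x, rfl⟩, y.2⟩
  · rintro ⟨⟨x, hx⟩, h⟩
    have e : D.coords x (fun l i j => a (Sum.inr (l, i, j))) = a := by
      funext i
      rcases i with i | i
      exacts [congrFun hx i, rfl]
    exact ⟨⟨(x, fun l i j => a (Sum.inr (l, i, j))), by rwa [e]⟩, e⟩

noncomputable instance imagSortY : ImagSort L M D.Y :=
  ImagSort.ofInjective Y.coords coords_injective (def_range_coords L M)

@[fun_prop]
theorem defMap_coords : DefMap L M (Y.coords (D := D)) :=
  DefMap.ofInjective Y.coords coords_injective (def_range_coords L M)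

@[fun_prop]
theorem defMap_xCode {f : E → D.Y} (hf : DefMap L M f) : DefMap L M fun e => D.xCode (f e).x :=
  DefMap.pi fun i => (defMap_coords.apply (Sum.inl i)).comp hf

@[fun_prop]
theorem defMap_t {f : E → D.Y} (hf : DefMap L M f) (l : Fin D.d) (i j : Fin D.n) :
    DefMap L M fun e => (f e).t l i j :=
  (defMap_coords.apply (Sum.inr (l, i, j))).comp hf

theorem IsRegular.defMap {φ : D.Y → k} (h : IsRegular φ) : DefMap L M φ := by
  obtain ⟨q, hq⟩ := h
  rw [show φ = _ from funext hq]
  fun_prop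

end QZGData

namespace QZGCover

variable {k : Type u} {A : Type v} [Field k] [Ring A] [Algebra k A]
  {D : QZGData.{u, v, w} k A} {Γ : Type w'} [Group Γ] [MulAction Γ D.Y] (S : QZGCover D Γ)
variable {L : Language} {M : Type*} [L.Structure M] [ImagSort L M k] [DefField L M k]
variable {E : Type*} [ImagSort L M E]

@[fun_prop]
theorem defMap_yCode {f : E → D.Y} (hf : DefMap L M f) : DefMap L M fun e => yCode (f e) := by
  unfold yCode
  fun_prop

theorem defMap_smul (S : QZGCover D Γ) (γ : Γ) : DefMap L M fun y : D.Y => γ • y := by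
  refine DefMap.of_comp_injective QZGData.defMap_coords QZGData.coords_injective
    (DefMap.pi fun i => ?_)
  rcases i with i | ⟨l, i, j⟩
  · change DefMap L M fun y : D.Y => D.xCode (γ • y).x i
    simp only [S.x_smul]
    fun_prop
  · exact (S.smul_regular γ l i j).defMap

/-- An arrow as a triple. -/
def arrowTriple (p : Arrow D) : D.Y × D.Y × k := (p.src, p.tgt, p.scal)

theorem arrowTriple_injective : Function.Injective (arrowTriple (D := D)) := fun _ _ h =>
  Arrow.ext (Prod.ext_iff.1 h).1 (Prod.ext_iff.1 (Prod.ext_iff.1 h).2).1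
    (Units.ext (Prod.ext_iff.1 (Prod.ext_iff.1 h).2).2)

variable (L M) in
theorem def_range_arrowTriple : Def L M fun a => ∃ p : Arrow D, arrowTriple p = a := by
  refine (Def.and (Def.eq (f := fun a : D.Y × D.Y × k => D.xCode a.1.x)
    (g := fun a : D.Y × D.Y × k => D.xCode a.2.1.x) (by fun_prop) (by fun_prop))
    (Def.not (Def.eq (f := fun a : D.Y × D.Y × k => a.2.2) (g := fun _ => 0)
      (by fun_prop) (by fun_prop)))).congr ?_
  rintro ⟨y, y', a⟩
  constructor
  · rintro ⟨p, hp⟩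
    simp only [arrowTriple, Prod.mk.injEq] at hp
    obtain ⟨rfl, rfl, rfl⟩ := hp
    exact ⟨congrArg _ p.fibre, p.scal.ne_zero⟩
  · rintro ⟨h, ha⟩
    exact ⟨⟨y, y', Units.mk0 a ha, xCode_injective h⟩, rfl⟩

noncomputable instance imagSortArrow : ImagSort L M (Arrow D) :=
  ImagSort.ofInjective arrowTriple arrowTriple_injective (def_range_arrowTriple L M)

theorem defMap_arrowTriple : DefMap L M (arrowTriple (D := D)) :=
  DefMap.ofInjective arrowTriple arrowTriple_injective (def_range_arrowTriple L M)

@[fun_prop]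
theorem defMap_src {f : E → Arrow D} (hf : DefMap L M f) : DefMap L M fun e => (f e).src :=
  (DefMap.fst defMap_arrowTriple).comp hf

@[fun_prop]
theorem defMap_tgt {f : E → Arrow D} (hf : DefMap L M f) : DefMap L M fun e => (f e).tgt :=
  (DefMap.fst (DefMap.snd defMap_arrowTriple)).comp hf

@[fun_prop]
theorem defMap_scal {f : E → Arrow D} (hf : DefMap L M f) :
    DefMap L M fun e => ((f e).scal : k) :=
  (DefMap.snd (DefMap.snd defMap_arrowTriple)).comp hf

@[fun_prop]
theorem defMap_arrCode {f : E → Arrow D} (hf : DefMap L M f) :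
    DefMap L M fun e => arrCode (f e) := by
  unfold arrCode
  fun_prop

/-- The matrix of an arrow, as a family of entries. -/
noncomputable def entries (p : Arrow D) (i j : Fin D.n) : k := (S.mat p).1 i j

theorem entries_eq (p : Arrow D) {γ : Γ} (h : γ • p.src = p.tgt) (i j : Fin D.n) :
    S.entries p i j = p.scal * (S.g γ p.src).1 i j := by
  rw [entries, mat, S.elt_eq p.fibre h, Units.val_mul, Matrix.GeneralLinearGroup.coe_scalar,
    Matrix.scalar_apply, Matrix.diagonal_mul]

-- The element `γ` joining the ends of an arrow depends on the arrow, but `Γ` is finite. A finite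
-- disjunction over `γ` therefore splits the arrows into pieces on which the entries are given by
-- regular functions.
@[fun_prop]
theorem defMap_entries {f : E → Arrow D} (hf : DefMap L M f) (i j : Fin D.n) :
    DefMap L M fun e => S.entries (f e) i j := by
  have := S.finite
  refine DefMap.comp (g := fun p => S.entries p i j) ?_ hf
  refine (Def.exists_finite fun γ : Γ => Def.and
    (Def.eq (f := fun p : Arrow D × k => γ • p.1.src) (g := fun p => p.1.tgt)
      ((S.defMap_smul γ).comp (by fun_prop)) (by fun_prop))
    (Def.eq (f := fun p : Arrow D × k => p.1.scal * (S.g γ p.1.src).1 i j) (g := fun p => p.2)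
      (DefMap.mul (by fun_prop) ((S.g_regular γ i j).defMap.comp (by fun_prop)))
      (by fun_prop))).congr ?_
  rintro ⟨p, c⟩
  constructor
  · intro h
    exact ⟨S.elt p.fibre, S.elt_smul p.fibre, (S.entries_eq p (S.elt_smul p.fibre) i j).symm.trans h⟩
  · rintro ⟨γ, h, h'⟩
    exact (S.entries_eq p h i j).trans h'

theorem mat_eq_iff {p : Arrow D} {C : GL (Fin D.n) k} :
    S.mat p = C ↔ ∀ i j, S.entries p i j = C.1 i j :=
  ⟨fun h i j => by rw [entries, h], fun h => Units.ext (Matrix.ext h)⟩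

/-! ### Definability of composition, identities and inverses. -/

variable [IsAlgClosed k]

/-- The cocycle was obtained by choice, so its definability is not visible. The composite is instead
pinned down by its ends and the product of the two matrices, which determine an arrow. -/
theorem comp_eq_iff {p q r : Arrow D} : (∃ h, S.comp p q h = r) ↔
    p.tgt = q.src ∧ r.src = p.src ∧ r.tgt = q.tgt ∧
      ∀ i j, S.entries r i j = ∑ l, S.entries p i l * S.entries q l j := by
  constructor
  · rintro ⟨h, rfl⟩
    exact ⟨h, rfl, rfl, S.mat_eq_iff.1 (S.mat_comp p q h)⟩
  · rintro ⟨h, h1, h2, h3⟩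
    exact ⟨h, S.arrow_ext h1.symm h2.symm ((S.mat_comp p q h).trans (S.mat_eq_iff.2 h3).symm)⟩

theorem def_comp : Def L M fun p : Arrow D × Arrow D × Arrow D =>
    ∃ h, S.comp p.1 p.2.1 h = p.2.2 := by
  refine (Def.and (Def.eq ?_ ?_) (Def.and (Def.eq ?_ ?_) (Def.and (Def.eq ?_ ?_)
    (Def.forall_finite fun i => Def.forall_finite fun j => Def.eq ?_ ?_)))).congr
      fun p => S.comp_eq_iff
  all_goals fun_prop

theorem defMap_one : DefMap L M S.one := by
  refine (Def.and (Def.eq (f := fun p : D.Y × Arrow D => p.2.src) (g := fun p => p.1) ?_ ?_)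
    (Def.and (Def.eq (f := fun p : D.Y × Arrow D => p.2.tgt) (g := fun p => p.1) ?_ ?_)
    (Def.forall_finite fun i => Def.forall_finite fun j =>
      Def.eq (f := fun p : D.Y × Arrow D => S.entries p.2 i j)
        (g := fun _ => (1 : GL (Fin D.n) k).1 i j) ?_ ?_))).congr ?_
  iterate 6 fun_prop
  rintro ⟨y, p⟩
  constructor
  · intro h
    obtain rfl : S.one y = p := h
    exact ⟨rfl, rfl, S.mat_eq_iff.1 (S.mat_one y)⟩
  · rintro ⟨h1, h2, h3⟩
    exact S.arrow_ext h1.symm h2.symm ((S.mat_one y).trans (S.mat_eq_iff.2 h3).symm)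

/-- The inverse of `p` is the only arrow out of `p.tgt` whose composite with `p` is an identity, so
the definability of composition and identities suffices. -/
theorem defMap_inv : DefMap L M S.inv := by
  refine (Def.exists (S := fun (p : Arrow D × Arrow D) r =>
    p.2.src = p.1.tgt ∧ (∃ h, S.comp p.1 p.2 h = r) ∧ S.one p.1.src = r) (Def.and (Def.eq ?_ ?_)
    (Def.and ((S.def_comp).comp (f := fun p : (Arrow D × Arrow D) × Arrow D =>
      (p.1.1, p.1.2, p.2)) ?_) (Def.eq (S.defMap_one.comp ?_) ?_)))).congr ?_
  iterate 5 fun_prop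
  rintro ⟨p, q⟩
  constructor
  · intro h
    obtain rfl : S.inv p = q := h
    refine ⟨_, rfl, ⟨rfl, rfl⟩, S.arrow_ext rfl rfl ?_⟩
    exact (S.mat_one _).trans ((S.mat_comp _ _ _).trans (S.mat_inv p)).symm
  · rintro ⟨r, h1, ⟨h2, h3⟩, h4⟩
    have h5 : p.src = q.tgt := by
      have := congrArg Arrow.tgt (h4.trans h3.symm)
      exact this
    refine S.arrow_ext h1.symm h5 ?_
    have h6 := S.mat_comp p q h2
    rw [h3, ← h4, S.mat_one] at h6
    exact mul_left_cancel ((S.mat_inv p).trans h6)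

end QZGCover

/-! ## Torsors of the splitting groupoid and frames of the geometry -/

namespace QZGCover

variable {k : Type u} {A : Type v} [Field k] [Ring A] [Algebra k A]
  {D : QZGData.{u, v, w} k A} {Γ : Type w'} [Group Γ] [MulAction Γ D.Y] (S : QZGCover D Γ)

theorem mat_intertwines (f : Arrow D) (l : Fin D.d) :
    f.src.t l * (S.mat f).1 = (S.mat f).1 * f.tgt.t l := by
  have h := S.intertwines (S.elt f.fibre) f.src l
  rw [S.elt_smul] at h
  change _ * (Matrix.scalar (Fin D.n) (f.scal : k) * _) =
    Matrix.scalar (Fin D.n) (f.scal : k) * _ * _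
  rw [Matrix.mul_assoc, ← h, ← Matrix.mul_assoc, ← Matrix.mul_assoc,
    (Matrix.scalar_commute (f.scal : k) (Commute.all _) _).eq]

variable [IsAlgClosed k]

/-- Choose a section `s` of `Y → X` and take the arrows that start on it, anchored at their targets,
with arrows acting by composition. The unique arrow taking `p` to `q` is the inverse of `p` followed
by `q`. -/
theorem exists_torsor : ∃ P : Type (max u v), Nonempty (S.splittingGroupoid.Torsor P) := by
  choose s hs using S.surjective
  refine ⟨{f : Arrow D // f.src = s f.src.x}, ⟨{
    anchor := fun p => p.1.tgt
    act := fun p f e => ⟨S.comp p.1 f e, p.2⟩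
    anchor_act := fun _ _ _ => rfl
    act_one := fun p => Subtype.ext (S.splittingGroupoid.comp_one p.1)
    act_comp := fun p f h e e' => Subtype.ext (S.splittingGroupoid.comp_assoc p.1 f h e e')
    proj_surjective := fun y =>
      ⟨⟨⟨s (QZGData.Y.x y), y, 1, hs _⟩, congrArg s (hs _).symm⟩, rfl⟩
    principal := ?_ }⟩⟩
  rintro ⟨p, hp⟩ ⟨q, hq⟩ h
  have hx : p.tgt.x = q.tgt.x := xCode_injective h
  have hsrc : (S.inv p).tgt = q.src := by
    change p.src = q.src
    rw [hp, hq, p.fibre, q.fibre, hx]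
  have key : ∀ f : Arrow D, (∃ e, S.comp p f e = q) ↔ f = S.comp (S.inv p) q hsrc := by
    intro f
    constructor
    · rintro ⟨e, rfl⟩
      refine S.arrow_ext e.symm rfl ?_
      rw [S.mat_comp, S.mat_comp, ← mul_assoc, mul_eq_one_comm.1 (S.mat_inv p), one_mul]
    · rintro rfl
      refine ⟨rfl, S.arrow_ext hsrc rfl ((S.mat_comp _ _ _).trans ?_)⟩
      rw [S.mat_comp, ← mul_assoc, S.mat_inv, one_mul]
  obtain ⟨e, h1⟩ := (key _).2 rfl
  refine ⟨S.comp (S.inv p) q hsrc, ⟨e, Subtype.ext h1⟩, ?_⟩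
  rintro f ⟨e, hf⟩
  exact (key f).1 ⟨e, congrArg Subtype.val hf⟩

variable {S} {P : Type w₂} (T : S.splittingGroupoid.Torsor P)

/-- The anchor of a point of a torsor of the splitting groupoid, as a point of `Y`. -/
def anch (p : P) : D.Y := T.anchor p

/-- The arrow `f` acts on `p` and takes it to `q`. -/
def ActsTo (p : P) (f : Arrow D) (q : P) : Prop :=
  ∃ e : anch T p = f.src, T.act p f e = q

variable {T}

theorem ActsTo.src_eq {p q : P} {f : Arrow D} (h : ActsTo T p f q) : f.src = anch T p := h.1.symm

theorem ActsTo.tgt_eq {p q : P} {f : Arrow D} (h : ActsTo T p f q) : f.tgt = anch T q := by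
  obtain ⟨e, rfl⟩ := h
  exact (T.anchor_act p f e).symm

theorem ActsTo.x_eq {p q : P} {f : Arrow D} (h : ActsTo T p f q) :
    (anch T p).x = (anch T q).x := by
  rw [← h.src_eq, ← h.tgt_eq, f.fibre]

theorem ActsTo.target_unique {p q q' : P} {f : Arrow D} (h : ActsTo T p f q)
    (h' : ActsTo T p f q') : q = q' := by
  obtain ⟨_, rfl⟩ := h
  exact h'.2

theorem ActsTo.trans {p q r : P} {f h : Arrow D} (hf : ActsTo T p f q) (hh : ActsTo T q h r) :
    ActsTo T p (S.comp f h (hf.tgt_eq.trans hh.src_eq.symm)) r := by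
  obtain ⟨e, rfl⟩ := hf
  obtain ⟨e', rfl⟩ := hh
  exact ⟨e, (T.act_comp p f h e ((T.anchor_act p f e).symm.trans e')).symm⟩

theorem actsTo_one (p : P) : ActsTo T p (S.one (anch T p)) p := ⟨rfl, T.act_one p⟩

theorem exists_actsTo_of_src {p : P} {f : Arrow D} (h : f.src = anch T p) :
    ∃ q, ActsTo T p f q := ⟨_, h.symm, rfl⟩

theorem existsUnique_actsTo {p q : P} (h : (anch T p).x = (anch T q).x) :
    ∃! f, ActsTo T p f q :=
  T.principal p q (congrArg D.xCode h)

theorem exists_anch_x (T : S.splittingGroupoid.Torsor P) (x : D.X) : ∃ p, (anch T p).x = x := by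
  obtain ⟨y, rfl⟩ := S.surjective x
  obtain ⟨p, hp⟩ := T.proj_surjective y
  exact ⟨p, xCode_injective hp⟩

/-- A torsor is only required to meet each fibre over `X`. An arrow with scalar `1` then moves a
point of the right fibre to one anchored at `y`. -/
theorem exists_anch (T : S.splittingGroupoid.Torsor P) (y : D.Y) : ∃ p, anch T p = y := by
  obtain ⟨p, hp⟩ := exists_anch_x T y.x
  obtain ⟨q, hq⟩ := exists_actsTo_of_src (T := T) (f := ⟨anch T p, y, 1, hp⟩) rfl
  exact ⟨q, hq.tgt_eq.symm⟩

end QZGCover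

namespace QZGeometry

variable {k : Type u} {A : Type v} [Field k] [Ring A] [Algebra k A]
  {D : QZGData.{u, v, w} k A} {Γ : Type w'} [Group Γ] [MulAction Γ D.Y] {S : QZGCover D Γ}

/-- The sort `V`: the total space of the family of fibres. -/
abbrev Total (G : QZGeometry.{u, v, w, w₁} D) : Type (max u v w₁) := Σ x : D.X, G.V x

variable [IsAlgClosed k] {P : Type w₂}

open QZGCover

/-- An equivariant family of coordinate systems on the fibres of the geometry, parametrised by a
torsor: at the point `p` the vector with coordinates `c` is `vec p c`. -/
structure Frame (G : QZGeometry.{u, v, w, w₁} D) (T : S.splittingGroupoid.Torsor P) where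
  vec : P → (Fin D.n → k) → G.Total
  equiv : ∀ p, (Fin D.n → k) ≃ₗ[k] G.V (anch T p).x
  vec_eq : ∀ p c, vec p c = ⟨_, equiv p c⟩
  op_equiv : ∀ l p c, G.op l _ (equiv p c) = equiv p ((anch T p).t l *ᵥ c)
  vec_act : ∀ {p f q}, ActsTo T p f q → ∀ c, vec q c = vec p ((S.mat f).1 *ᵥ c)

/-- The action of an invertible matrix on columns. -/
noncomputable def mulVecEquiv {n : ℕ} (C : GL (Fin n) k) : (Fin n → k) ≃ₗ[k] (Fin n → k) :=
  { Matrix.mulVecLin C.1 with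
    invFun := fun c => C.inv *ᵥ c
    left_inv := fun c => (Matrix.mulVec_mulVec _ _ _).trans (by rw [C.inv_val, Matrix.one_mulVec])
    right_inv := fun c => (Matrix.mulVec_mulVec c C.1 C.inv).trans
      (by rw [C.val_inv, Matrix.one_mulVec]) }

/-- In each fibre choose a base point `p₀ x` and a basis `b x` of `V_x` in which the operators act
by the matrices of its anchor. Coordinates `c` at `p` mean coordinates `(S.mat g) c` in `b x`, where
`g` is the unique arrow from the base point to `p`. Compatibility with the operators is the
intertwining property of `S.mat g`. -/
theorem exists_frame (G : QZGeometry.{u, v, w, w₁} D) (T : S.splittingGroupoid.Torsor P) :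
    Nonempty (Frame G T) := by
  have h0 : ∀ x, ∃ p, (anch T p).x = x ∧ ∃ b : Module.Basis (Fin D.n) k (G.V x),
      ∀ l j, G.op l x (b j) = ∑ i, (anch T p).t l i j • b i := by
    intro x
    obtain ⟨p, rfl⟩ := exists_anch_x T x
    exact ⟨p, rfl, G.exists_basis (anch T p)⟩
  choose p₀ hp₀ b hb using h0
  choose g hg using fun (x : D.X) (p : P) (h : x = (anch T p).x) =>
    (existsUnique_actsTo (T := T) ((hp₀ x).trans h)).exists
  have hop : ∀ l x c, G.op l x ((b x).equivFun.symm c) =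
      (b x).equivFun.symm ((anch T (p₀ x)).t l *ᵥ c) := by
    intro l x c
    simp only [Module.Basis.equivFun_symm_apply, map_sum, map_smul, hb, Matrix.mulVec, dotProduct,
      Finset.sum_smul, Finset.smul_sum, smul_smul]
    rw [Finset.sum_comm]
    simp only [mul_comm]
  obtain ⟨φ, hφ⟩ : ∃ φ : ∀ p, (Fin D.n → k) ≃ₗ[k] G.V (anch T p).x,
      ∀ p c, φ p c = (b (anch T p).x).equivFun.symm ((S.mat (g _ p rfl)).1 *ᵥ c) :=
    ⟨fun p => (mulVecEquiv (S.mat (g _ p rfl))).trans (b (anch T p).x).equivFun.symm, fun _ _ => rfl⟩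
  refine ⟨⟨fun p c => ⟨_, φ p c⟩, φ, fun _ _ => rfl, ?_, ?_⟩⟩
  · intro l p c
    have h := S.mat_intertwines (g _ p rfl) l
    rw [(hg _ p rfl).src_eq, (hg _ p rfl).tgt_eq] at h
    rw [hφ, hφ, hop, Matrix.mulVec_mulVec, Matrix.mulVec_mulVec, h]
  · intro p f q hf c
    -- By uniqueness, the arrow from the base point to `q` is the composite through `p`. The point
    -- `x` is kept variable because the anchors of `p` and `q` lie over points that are only
    -- propositionally equal, while `g` and `b` depend on that point.
    have key : ∀ (x : D.X) (h : x = (anch T q).x) (h' : x = (anch T p).x),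
        S.mat (g x q h) = S.mat (g x p h') * S.mat f := by
      intro x h h'
      rw [← S.mat_comp _ _ ((hg x p h').tgt_eq.trans hf.src_eq.symm)]
      exact congrArg _ ((existsUnique_actsTo (T := T) ((hp₀ x).trans h)).unique (hg x q h)
        ((hg x p h').trans hf))
    have key' : ∀ (x : D.X) (h : x = (anch T q).x),
        (⟨_, φ q c⟩ : G.Total) = ⟨x, (b x).equivFun.symm ((S.mat (g x q h)).1 *ᵥ c)⟩ := by
      rintro _ rfl
      rw [hφ]
    rw [key' _ hf.x_eq, key _ hf.x_eq rfl, Units.val_mul, ← Matrix.mulVec_mulVec, ← hφ]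

/-! ### The basic relations on the sort `V` -/

variable (G : QZGeometry.{u, v, w, w₁} D)

/-- The graph of addition in the fibres. -/
def AddRel (s : G.Total × G.Total × G.Total) : Prop :=
  ∃ (x : D.X) (a b : G.V x), s = (⟨x, a⟩, ⟨x, b⟩, ⟨x, a + b⟩)

/-- The graph of multiplication by scalars in the fibres. -/
def SmulRel (s : k × G.Total × G.Total) : Prop :=
  ∃ (c : k) (x : D.X) (a : G.V x), s = (c, ⟨x, a⟩, ⟨x, c • a⟩)

/-- The graphs of the operators. -/
def OpRel (l : Fin D.d) (s : G.Total × G.Total) : Prop :=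
  ∃ (x : D.X) (a : G.V x), s = (⟨x, a⟩, ⟨x, G.op l x a⟩)

/-- The graph of the formation of linear combinations in the fibres. -/
def CombRel (n : ℕ) (s : (Fin n → k) × (Fin n → G.Total) × G.Total) : Prop :=
  ∃ (x : D.X) (b : Fin n → G.V x), (s.2.1 = fun i => ⟨x, b i⟩) ∧ s.2.2 = ⟨x, ∑ i, s.1 i • b i⟩

variable (L : Language) (M : Type*) [L.Structure M] [ImagSort L M k]

/-- The sort `V` with all its basic relations is definable on an imaginary sort of `M`. -/
class DefTotal [ImagSort L M G.Total] : Prop where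
  proj : DefMap L M fun s : G.Total => D.xCode s.1
  add : Def L M G.AddRel
  smul : Def L M G.SmulRel
  op : ∀ l, Def L M (G.OpRel l)

end QZGeometry

open QZGCover

/-! ## From a torsor to the geometry -/

namespace QZGeometry

section OfTorsor

variable {k : Type u} {A : Type v} [Field k] [IsAlgClosed k] [Ring A] [Algebra k A]
  {D : QZGData.{u, v, w} k A} {Γ : Type w'} [Group Γ] [MulAction Γ D.Y] {S : QZGCover D Γ}
  {P : Type w₂} {T : S.splittingGroupoid.Torsor P} {G : QZGeometry.{u, v, w, w₁} D}
  (F : Frame G T)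

theorem Frame.vec_mk_eq_iff {p : P} {c : Fin D.n → k} {a : G.V (anch T p).x} :
    F.vec p c = ⟨_, a⟩ ↔ F.equiv p c = a := by
  rw [F.vec_eq]
  exact ⟨fun h => eq_of_heq (Sigma.mk.inj h).2, fun h => by rw [h]⟩

theorem Frame.exists_vec (s : G.Total) : ∃ p c, F.vec p c = s := by
  obtain ⟨x, a⟩ := s
  obtain ⟨p, rfl⟩ := exists_anch_x T x
  exact ⟨p, (F.equiv p).symm a, by rw [F.vec_mk_eq_iff, LinearEquiv.apply_symm_apply]⟩

theorem Frame.vec_fst (p : P) (c : Fin D.n → k) : (F.vec p c).1 = (anch T p).x := by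
  rw [F.vec_eq]

theorem Frame.vec_injective (p : P) : Function.Injective (F.vec p) := by
  intro c c' h
  rw [F.vec_eq p c', F.vec_mk_eq_iff] at h
  exact (F.equiv p).injective h

/-- Equal vectors lie in one fibre, so an arrow joins `p` to `q` and the coordinates can be compared
at `p`. The right-hand side does not mention the frame; this makes the equivalence relation on `P ×
k^n` definable from the torsor alone. -/
theorem Frame.vec_eq_iff {p q : P} {c c' : Fin D.n → k} : F.vec p c = F.vec q c' ↔
    ∃ f, ActsTo T p f q ∧ ∀ i, c i = ∑ j, S.entries f i j * c' j := by
  constructor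
  · intro h
    have hx : (anch T p).x = (anch T q).x := by rw [← F.vec_fst p c, ← F.vec_fst q c', h]
    obtain ⟨f, hf, -⟩ := existsUnique_actsTo hx
    rw [F.vec_act hf] at h
    exact ⟨f, hf, fun i => congrFun (F.vec_injective p h) i⟩
  · rintro ⟨f, hf, h⟩
    rw [F.vec_act hf]
    exact congrArg _ (funext h)

/-- Vectors of one fibre can all be written in coordinates at a single point `p`, where addition is
coordinatewise. -/
theorem Frame.addRel_iff {s : G.Total × G.Total × G.Total} : G.AddRel s ↔
    ∃ p c c', F.vec p c = s.1 ∧ F.vec p c' = s.2.1 ∧ F.vec p (fun i => c i + c' i) = s.2.2 := by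
  constructor
  · rintro ⟨x, a, b, rfl⟩
    obtain ⟨p, rfl⟩ := exists_anch_x T x
    refine ⟨p, (F.equiv p).symm a, (F.equiv p).symm b, ?_⟩
    rw [F.vec_mk_eq_iff, F.vec_mk_eq_iff, F.vec_mk_eq_iff]
    exact ⟨by simp, by simp, ((F.equiv p).map_add _ _).trans (by simp)⟩
  · obtain ⟨s1, s2, s3⟩ := s
    rintro ⟨p, c, c', rfl, rfl, rfl⟩
    refine ⟨_, F.equiv p c, F.equiv p c', ?_⟩
    rw [← map_add, ← F.vec_eq, ← F.vec_eq, ← F.vec_eq]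
    rfl

theorem Frame.smulRel_iff {s : k × G.Total × G.Total} : G.SmulRel s ↔
    ∃ p c, F.vec p c = s.2.1 ∧ F.vec p (fun i => s.1 * c i) = s.2.2 := by
  constructor
  · rintro ⟨e, x, a, rfl⟩
    obtain ⟨p, rfl⟩ := exists_anch_x T x
    refine ⟨p, (F.equiv p).symm a, ?_⟩
    rw [F.vec_mk_eq_iff, F.vec_mk_eq_iff]
    exact ⟨by simp, ((F.equiv p).map_smul e _).trans (by simp)⟩
  · obtain ⟨e, s2, s3⟩ := s
    rintro ⟨p, c, h1, h2⟩
    obtain rfl : F.vec p c = s2 := h1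
    obtain rfl : F.vec p (fun i => e * c i) = s3 := h2
    refine ⟨e, _, F.equiv p c, ?_⟩
    rw [← map_smul, ← F.vec_eq, ← F.vec_eq]
    rfl

theorem Frame.opRel_iff (l : Fin D.d) {s : G.Total × G.Total} : G.OpRel l s ↔
    ∃ p c, F.vec p c = s.1 ∧ F.vec p (fun i => ∑ j, (anch T p).t l i j * c j) = s.2 := by
  constructor
  · rintro ⟨x, a, rfl⟩
    obtain ⟨p, rfl⟩ := exists_anch_x T x
    refine ⟨p, (F.equiv p).symm a, ?_⟩
    rw [F.vec_mk_eq_iff, F.vec_mk_eq_iff]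
    exact ⟨by simp, (F.op_equiv l p _).symm.trans (by simp)⟩
  · obtain ⟨s1, s2⟩ := s
    rintro ⟨p, c, rfl, rfl⟩
    refine ⟨_, F.equiv p c, ?_⟩
    rw [F.op_equiv, ← F.vec_eq, ← F.vec_eq]
    rfl

variable {L : Language} {M : Type*} [L.Structure M] [ImagSort L M k] [DefField L M k]
  [ImagSort L M P]

theorem Frame.def_vec_eq
    (hact : Def L M fun s : P × Arrow D × P => ActsTo T s.1 s.2.1 s.2.2) :
    Def L M fun s : (P × (Fin D.n → k)) × (P × (Fin D.n → k)) =>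
      F.vec s.1.1 s.1.2 = F.vec s.2.1 s.2.2 := by
  refine (Def.exists (S := fun (s : (P × (Fin D.n → k)) × (P × (Fin D.n → k))) f =>
    ActsTo T s.1.1 f s.2.1 ∧ ∀ i, s.1.2 i = ∑ j, S.entries f i j * s.2.2 j) (Def.and
    (hact.comp (f := fun s : ((P × (Fin D.n → k)) × (P × (Fin D.n → k))) × Arrow D =>
      (s.1.1.1, s.2, s.1.2.1)) ?_) (Def.forall_finite fun i => Def.eq ?_ ?_))).congr
    fun s => F.vec_eq_iff
  all_goals fun_prop

/-- The sort `V` as a quotient of the product of the torsor with the space of coordinates. -/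
theorem Frame.exists_defTotal (F : Frame G T)
    (hanch : DefMap L M fun p => anch T p)
    (hact : Def L M fun s : P × Arrow D × P => ActsTo T s.1 s.2.1 s.2.2) :
    ∃ _ : ImagSort L M G.Total, DefTotal G L M := by
  let f : P × (Fin D.n → k) → G.Total := fun s => F.vec s.1 s.2
  have hf : Function.Surjective f := fun s => by
    obtain ⟨p, c, h⟩ := F.exists_vec s
    exact ⟨(p, c), h⟩
  let _ := ImagSort.ofSurjective f hf (F.def_vec_eq hact)
  have hd : DefMap L M f := DefMap.ofSurjective f hf (F.def_vec_eq hact)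
  have hvec : ∀ {E : Type (max u w₂ v w₁)} [ImagSort L M E] {p : E → P} {c : E → Fin D.n → k},
      DefMap L M p → DefMap L M c → DefMap L M fun e => F.vec (p e) (c e) :=
    fun hp hc => hd.comp (hp.prodMk hc)
  refine ⟨inferInstance, ⟨?_, ?_, ?_, fun l => ?_⟩⟩
  · refine (Def.exists (S := fun (s : G.Total × (Fin D.m → k)) (q : P × (Fin D.n → k)) =>
      f q = s.1 ∧ D.xCode (anch T q.1).x = s.2) (Def.and (Def.eq ?_ ?_) (Def.eq ?_ ?_))).congr ?_
    iterate 4 fun_prop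
    rintro ⟨s, a⟩
    constructor
    · intro h
      obtain rfl : D.xCode s.1 = a := h
      obtain ⟨p, c, rfl⟩ := F.exists_vec s
      exact ⟨(p, c), rfl, by rw [F.vec_fst]⟩
    · rintro ⟨⟨p, c⟩, h1, h2⟩
      simp only at h1 h2 ⊢
      rw [← h1, ← h2]
      exact congrArg _ (F.vec_fst p c)
  · refine (Def.exists (S := fun s p => ∃ c c', F.vec p c = s.1 ∧ F.vec p c' = s.2.1 ∧
      F.vec p (fun i => c i + c' i) = s.2.2) (Def.exists (Def.exists
        (Def.and (Def.eq (hvec ?_ ?_) ?_) (Def.and (Def.eq (hvec ?_ ?_) ?_)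
          (Def.eq (hvec ?_ ?_) ?_)))))).congr fun s => F.addRel_iff
    all_goals fun_prop
  · refine (Def.exists (S := fun s p => ∃ c, F.vec p c = s.2.1 ∧
      F.vec p (fun i => s.1 * c i) = s.2.2) (Def.exists
        (Def.and (Def.eq (hvec ?_ ?_) ?_) (Def.eq (hvec ?_ ?_) ?_)))).congr fun s => F.smulRel_iff
    all_goals fun_prop
  · refine (Def.exists (S := fun s p => ∃ c, F.vec p c = s.1 ∧
      F.vec p (fun i => ∑ j, (anch T p).t l i j * c j) = s.2) (Def.exists
        (Def.and (Def.eq (hvec ?_ ?_) ?_) (Def.eq (hvec ?_ ?_) ?_)))).congr fun s => F.opRel_iff l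
    all_goals fun_prop

end OfTorsor

section Interpretable

variable {k : Type u} {A : Type v} [Field k] [Ring A] [Algebra k A]
  {D : QZGData.{u, v, w} k A} (G : QZGeometry.{u, v, w, w₁} D)
  (L : Language) (M : Type*) [L.Structure M] [ImagSort L M k] [DefField L M k]

/-- The universe of the geometry is the sum of the sorts `k` and `V`. Each basic relation is the
image of a definable relation on these two sorts. -/
theorem interpretableOver_geometry [Nontrivial M] [ImagSort L M G.Total] [DefTotal G L M]
    {a : k → M} (ha : DefMap L M a) :
    InterpretableOver L M (geomLang D.m D.d) G.Carrier a G.ofField := by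
  let _ : ImagSort L M G.Carrier := inferInstanceAs (ImagSort L M (k ⊕ G.Total))
  have hk : DefMap L M G.ofField := DefMap.inl (E := k) (F := G.Total)
  let vec : G.Total → G.Carrier := Sum.inr
  have hv : DefMap L M vec := DefMap.inr (E := k) (F := G.Total)
  have hproj := DefTotal.proj (G := G) (L := L) (M := M)
  refine interpretableOver_of_imagSort (fun {j} R => ?_) (fun f => Empty.elim f) a G.ofField ?_
  · change GeomRel D.m D.d j at R
    cases R with
    | isField =>
      refine Def.exists (S := fun (x : Fin 1 → G.Carrier) c => x 0 = G.ofField c) (Def.eq ?_ ?_)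
      all_goals fun_prop
    | add =>
      refine Def.exists (S := fun (x : Fin 3 → G.Carrier) c => ∃ c', x =
        ![G.ofField c, G.ofField c', G.ofField (c + c')]) (Def.exists (Def.eq ?_ ?_))
      all_goals fun_prop
    | mul =>
      refine Def.exists (S := fun (x : Fin 3 → G.Carrier) c => ∃ c', x =
        ![G.ofField c, G.ofField c', G.ofField (c * c')]) (Def.exists (Def.eq ?_ ?_))
      all_goals fun_prop
    | proj =>
      refine (Def.exists (S := fun (x : Fin (D.m + 1) → G.Carrier) (s : G.Total) => x =
        Fin.cons (vec s) fun i => G.ofField (D.xCode s.1 i)) (Def.eq ?_ ?_)).congr fun x => ?_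
      · fun_prop
      · refine DefMap.finCons ?_ (DefMap.pi fun i => hk.comp ((hproj.apply i).comp ?_))
        all_goals fun_prop
      · constructor
        · rintro ⟨y, a, h⟩
          exact ⟨⟨y, a⟩, h⟩
        · rintro ⟨⟨y, a⟩, h⟩
          exact ⟨y, a, h⟩
    | vadd =>
      refine (Def.exists (S := fun (x : Fin 3 → G.Carrier) s => G.AddRel s ∧
        x = ![vec s.1, vec s.2.1, vec s.2.2])
        (Def.and (DefTotal.add.comp ?_) (Def.eq ?_ ?_))).congr fun x => ?_
      iterate 3 fun_prop
      constructor
      · rintro ⟨y, a, b, rfl⟩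
        exact ⟨_, ⟨y, a, b, rfl⟩, rfl⟩
      · rintro ⟨_, ⟨y, a, b, rfl⟩, rfl⟩
        exact ⟨y, a, b, rfl⟩
    | smul =>
      refine (Def.exists (S := fun (x : Fin 3 → G.Carrier) s => G.SmulRel s ∧
        x = ![G.ofField s.1, vec s.2.1, vec s.2.2])
        (Def.and (DefTotal.smul.comp ?_) (Def.eq ?_ ?_))).congr fun x => ?_
      iterate 3 fun_prop
      constructor
      · rintro ⟨c, y, a, rfl⟩
        exact ⟨_, ⟨c, y, a, rfl⟩, rfl⟩
      · rintro ⟨_, ⟨c, y, a, rfl⟩, rfl⟩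
        exact ⟨c, y, a, rfl⟩
    | op l =>
      refine (Def.exists (S := fun (x : Fin 2 → G.Carrier) s => G.OpRel l s ∧
        x = ![vec s.1, vec s.2]) (Def.and ((DefTotal.op l).comp ?_) (Def.eq ?_ ?_))).congr
          fun x => ?_
      iterate 3 fun_prop
      constructor
      · rintro ⟨y, a, rfl⟩
        exact ⟨_, ⟨y, a, rfl⟩, rfl⟩
      · rintro ⟨_, ⟨y, a, rfl⟩, rfl⟩
        exact ⟨y, a, rfl⟩
  · refine Def.exists (S := fun (p : M × G.Carrier) c => p.1 = a c ∧ p.2 = G.ofField c)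
      (Def.and (Def.eq ?_ ?_) (Def.eq ?_ ?_))
    all_goals fun_prop

end Interpretable

end QZGeometry

/-! ## From the geometry to a torsor -/

namespace QZGeometry

variable {k : Type u} {A : Type v} [Field k] [Ring A] [Algebra k A]
  {D : QZGData.{u, v, w} k A} {G : QZGeometry.{u, v, w, w₁} D}

/-- Expresses that a vector is zero through the basic relations alone: the language has no symbol
for the zero of a fibre. -/
theorem smulRel_zero_self_iff {x : D.X} {a : G.V x} :
    G.SmulRel (0, ⟨x, a⟩, ⟨x, a⟩) ↔ a = 0 := by
  constructor
  · rintro ⟨c, y, b, h⟩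
    simp only [Prod.mk.injEq] at h
    obtain ⟨rfl, h1, h2⟩ := h
    cases h1
    simpa using h2
  · rintro rfl
    exact ⟨0, x, 0, by simp⟩

theorem combRel_zero_iff {s : (Fin 0 → k) × (Fin 0 → G.Total) × G.Total} :
    G.CombRel 0 s ↔ G.SmulRel (0, s.2.2, s.2.2) := by
  obtain ⟨c, b, x, a⟩ := s
  rw [smulRel_zero_self_iff]
  constructor
  · rintro ⟨y, b', -, h⟩
    obtain rfl : x = y := congrArg Sigma.fst h
    simpa using eq_of_heq (Sigma.mk.inj h).2
  · rintro rfl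
    exact ⟨x, finZeroElim, Subsingleton.elim _ _, by simp⟩

/-- Splitting off the last summand gives, by induction, a first-order definition of linear
combinations. That all vectors lie in one fibre is forced by the graph of addition. -/
theorem combRel_succ_iff {n : ℕ} {s : (Fin (n + 1) → k) × (Fin (n + 1) → G.Total) × G.Total} :
    G.CombRel (n + 1) s ↔ ∃ t t', G.CombRel n (fun i => s.1 i.castSucc, fun i => s.2.1 i.castSucc, t) ∧
      G.SmulRel (s.1 (Fin.last n), s.2.1 (Fin.last n), t') ∧ G.AddRel (t, t', s.2.2) := by
  obtain ⟨c, b, a⟩ := s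
  constructor
  · rintro ⟨x, b', h1, h2⟩
    obtain rfl : b = fun i => ⟨x, b' i⟩ := h1
    obtain rfl : a = ⟨x, ∑ i, c i • b' i⟩ := h2
    exact ⟨⟨x, ∑ i : Fin n, c i.castSucc • b' i.castSucc⟩, ⟨x, c (Fin.last n) • b' (Fin.last n)⟩,
      ⟨x, fun i => b' i.castSucc, rfl, rfl⟩, ⟨_, x, _, rfl⟩,
      ⟨x, ∑ i : Fin n, c i.castSucc • b' i.castSucc, c (Fin.last n) • b' (Fin.last n),
        by simp only [Fin.sum_univ_castSucc]⟩⟩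
  · rintro ⟨t, t', ⟨x, b', h1, h2⟩, ⟨e, y, a', h3⟩, ⟨z, a1, a2, h4⟩⟩
    simp only [Prod.mk.injEq] at h1 h2 h3 h4
    obtain ⟨rfl, h5, rfl⟩ := h3
    obtain ⟨h6, h7, rfl⟩ := h4
    subst h2
    cases h6
    cases h7
    refine ⟨x, Fin.snoc b' a', ?_, ?_⟩
    · funext i
      induction i using Fin.lastCases with
      | last => simpa using h5
      | cast i => simpa using congrFun h1 i
    · simp [Fin.sum_univ_castSucc]

section Definable

variable {L : Language} {M : Type*} [L.Structure M] [ImagSort L M k] [ImagSort L M G.Total]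
  [DefTotal G L M]

theorem def_combRel (n : ℕ) : Def L M (G.CombRel n) := by
  induction n with
  | zero =>
    refine (DefTotal.smul.comp (f := fun s : (Fin 0 → k) × (Fin 0 → G.Total) × G.Total =>
      (0, s.2.2, s.2.2)) ?_).congr fun s => combRel_zero_iff
    fun_prop
  | succ n ih =>
    refine (Def.exists (S := fun (s : (Fin (n + 1) → k) × (Fin (n + 1) → G.Total) × G.Total) t =>
      ∃ t', G.CombRel n (fun i => s.1 i.castSucc, fun i => s.2.1 i.castSucc, t) ∧
        G.SmulRel (s.1 (Fin.last n), s.2.1 (Fin.last n), t') ∧ G.AddRel (t, t', s.2.2))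
      (Def.exists (Def.and (ih.comp ?_) (Def.and (DefTotal.smul.comp ?_)
        (DefTotal.add.comp ?_))))).congr fun s => combRel_succ_iff
    all_goals fun_prop

end Definable

/-! ### The torsor as a definable family of bases. -/

variable [IsAlgClosed k] {Γ : Type w'} [Group Γ] [MulAction Γ D.Y] {S : QZGCover D Γ}
  {P : Type w₂} {T : S.splittingGroupoid.Torsor P} (F : Frame G T)

/-- Rescale the identity arrow by `c`. Its scalar component is the inverse of the cocycle at `(1,
1)`, which need not be `1`. -/
theorem _root_.QZGCover.exists_mat_eq_scalar (S : QZGCover D Γ) (y : D.Y) (c : kˣ) :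
    ∃ f : Arrow D, f.src = y ∧ f.tgt = y ∧
      S.mat f = Matrix.GeneralLinearGroup.scalar (Fin D.n) c := by
  refine ⟨⟨y, y, c * (S.one y).scal, rfl⟩, rfl, rfl, ?_⟩
  have h := S.mat_one y
  rw [mat] at h ⊢
  rw [map_mul, mul_assoc]
  exact (congrArg _ h).trans (mul_one _)

/-- The basis of a fibre given by a point of the torsor. -/
def Frame.basisVec (p : P) (j : Fin D.n) : G.Total := F.vec p (Pi.single j 1)

theorem Frame.combRel_basisVec_iff {p : P} {c : Fin D.n → k} {s : G.Total} :
    G.CombRel D.n (c, F.basisVec p, s) ↔ s = F.vec p c := by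
  have hsum : ∑ i, c i • F.equiv p (Pi.single i 1) = F.equiv p c := by
    simp only [← map_smul, ← map_sum]
    exact congrArg _ (pi_eq_sum_univ' c).symm
  constructor
  · rintro ⟨x, b, h1, h2⟩
    simp only at h1 h2
    -- At least one basis vector is needed to identify the fibre `x`; an empty combination would not
    -- determine it.
    obtain ⟨j⟩ := QZGData.nonempty_fin (anch T p)
    obtain rfl : (anch T p).x = x := by
      rw [← F.vec_fst p (Pi.single j 1)]
      exact congrArg Sigma.fst (congrFun h1 j)
    rw [h2, F.vec_eq, ← hsum]
    congr 1
    refine Finset.sum_congr rfl fun i _ => ?_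
    rw [F.vec_mk_eq_iff.1 (congrFun h1 i)]
  · rintro rfl
    refine ⟨_, fun i => F.equiv p (Pi.single i 1), funext fun i => F.vec_eq _ _, ?_⟩
    rw [F.vec_eq]
    exact congrArg _ hsum.symm

theorem Frame.basisVec_act {p q : P} {f : Arrow D} (h : ActsTo T p f q) (j : Fin D.n) :
    F.basisVec q j = F.vec p fun i => S.entries f i j := by
  rw [basisVec, F.vec_act h, Matrix.mulVec_single_one]
  rfl

/-- The columns of the matrix of `f` are the coordinates at `p` of the basis at `q`. Conversely, the
arrow that does take `p` to `q` has the same ends and the same matrix as `f`, hence equals `f`. The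
action thus becomes visible in the geometry. -/
theorem Frame.actsTo_iff {p q : P} {f : Arrow D} : ActsTo T p f q ↔
    f.src = anch T p ∧ f.tgt = anch T q ∧
      ∀ j, G.CombRel D.n (fun i => S.entries f i j, F.basisVec p, F.basisVec q j) := by
  simp only [F.combRel_basisVec_iff]
  constructor
  · exact fun h => ⟨h.src_eq, h.tgt_eq, F.basisVec_act h⟩
  · rintro ⟨h1, h2, h3⟩
    obtain ⟨f', hf', -⟩ := existsUnique_actsTo (T := T) (p := p) (q := q)
      (by rw [← h1, ← h2, f.fibre])
    rwa [S.arrow_ext (p := f) (q := f') (h1.trans hf'.src_eq.symm) (h2.trans hf'.tgt_eq.symm)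
      (S.mat_eq_iff.2 fun i j => congrFun (F.vec_injective p
        ((h3 j).symm.trans (F.basisVec_act hf' j))) i)]

/-- A point of the torsor as a point of `Y` together with a basis of the fibre. -/
def Frame.emb (p : P) : D.Y × (Fin D.n → G.Total) := (anch T p, F.basisVec p)

/-- If `p` and `q` have the same anchor and basis, the change of basis is trivial, so the identity
arrow at the anchor takes `p` to `q`. -/
theorem Frame.emb_injective : Function.Injective F.emb := by
  intro p q h
  obtain ⟨h1, h2⟩ := Prod.ext_iff.1 h
  have h1 : anch T p = anch T q := h1
  have h2 : F.basisVec p = F.basisVec q := h2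
  have h3 : ActsTo T p (S.one (anch T p)) q := by
    refine F.actsTo_iff.2 ⟨rfl, h1, fun j => ?_⟩
    rw [← h2]
    exact (F.actsTo_iff.1 (actsTo_one p)).2.2 j
  exact (actsTo_one p).target_unique h3

/-- The equations say that the coordinate matrix of the tuple, at a point of the torsor anchored at
the given `y`, commutes with the matrices of `y`; so it is scalar by Schur's lemma. Hence one
non-zero vector is enough to make the tuple a basis, and linear independence need not be expressed.
-/
theorem Frame.exists_emb_eq_iff {a : D.Y × (Fin D.n → G.Total)} : (∃ p, F.emb p = a) ↔
    (∀ j, D.xCode (a.2 j).1 = D.xCode a.1.x) ∧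
    (∀ l j, ∃ s, G.OpRel l (a.2 j, s) ∧ G.CombRel D.n (fun i => a.1.t l i j, a.2, s)) ∧
    ∃ j, ¬ G.SmulRel (0, a.2 j, a.2 j) := by
  constructor
  · rintro ⟨p, rfl⟩
    refine ⟨fun j => congrArg _ (F.vec_fst p _), fun l j =>
      ⟨F.vec p fun i => (anch T p).t l i j, ?_, F.combRel_basisVec_iff.2 rfl⟩, ?_⟩
    · refine ⟨_, F.equiv p (Pi.single j 1), ?_⟩
      rw [F.op_equiv, Matrix.mulVec_single_one, ← F.vec_eq, ← F.vec_eq]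
      rfl
    · obtain ⟨j⟩ := QZGData.nonempty_fin (anch T p)
      refine ⟨j, ?_⟩
      change ¬ G.SmulRel (0, F.vec p (Pi.single j 1), F.vec p (Pi.single j 1))
      rw [F.vec_eq, smulRel_zero_self_iff, LinearEquiv.map_eq_zero_iff]
      intro h
      simpa using congrFun h j
  · obtain ⟨y, b⟩ := a
    rintro ⟨h1, h2, j₀, h3⟩
    obtain ⟨p, rfl⟩ := exists_anch T y
    have h4 : ∀ j, ∃ c, b j = F.vec p c := by
      intro j
      have hx : (b j).1 = (anch T p).x := xCode_injective (h1 j)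
      rcases hb : b j with ⟨x, a⟩
      rw [hb] at hx
      obtain rfl : x = (anch T p).x := hx
      exact ⟨(F.equiv p).symm a, by rw [F.vec_eq, LinearEquiv.apply_symm_apply]⟩
    choose c hc using h4
    let C : Matrix (Fin D.n) (Fin D.n) k := Matrix.of fun i j => c j i
    -- Column `j` compares two expressions for `u_l b_j`: the operator computed in coordinates at
    -- `p`, and the prescribed combination of the `b_i`.
    have hC : ∀ l, (anch T p).t l * C = C * (anch T p).t l := by
      intro l
      ext i j
      obtain ⟨s, ⟨x, a, h5⟩, ⟨x', b', h6, h7⟩⟩ := h2 l j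
      simp only [Prod.mk.injEq] at h5 h6 h7
      obtain ⟨h5, rfl⟩ := h5
      have hx : (anch T p).x = x := by
        rw [← F.vec_fst p (c j), ← hc, h5]
      subst hx
      have hx' : (anch T p).x = x' := congrArg Sigma.fst h7
      subst hx'
      have h8 : F.equiv p (c j) = a := by
        rw [← F.vec_mk_eq_iff, ← hc, h5]
      have h9 : ∀ i, F.equiv p (c i) = b' i := fun i => by
        rw [← F.vec_mk_eq_iff, ← hc, h6]
      have h10 := eq_of_heq (Sigma.mk.inj h7).2
      rw [← h8, F.op_equiv] at h10
      simp only [← h9, ← map_smul, ← map_sum] at h10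
      have h11 := congrFun ((F.equiv p).injective h10) i
      simp only [Matrix.mulVec, dotProduct, Finset.sum_apply, Pi.smul_apply, smul_eq_mul] at h11
      simp only [Matrix.mul_apply, C, Matrix.of_apply]
      rw [h11]
      exact Finset.sum_congr rfl fun _ _ => mul_comm _ _
    obtain ⟨e, he⟩ := QZGData.schur _ C hC
    have hce : ∀ j, c j = fun i => Matrix.scalar (Fin D.n) e i j := fun j => by
      rw [← he]
      rfl
    have he0 : e ≠ 0 := by
      rintro rfl
      apply h3
      simp only
      rw [hc, hce, F.vec_eq, smulRel_zero_self_iff, LinearEquiv.map_eq_zero_iff]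
      simp
      rfl
    -- Moving `p` along the loop with matrix `e` keeps the anchor and multiplies the basis by `e`,
    -- which gives the tuple `b`.
    obtain ⟨f, hf1, hf2, hf3⟩ := S.exists_mat_eq_scalar (anch T p) (Units.mk0 e he0)
    obtain ⟨q, hq⟩ := exists_actsTo_of_src hf1
    refine ⟨q, Prod.ext (hq.tgt_eq.symm.trans hf2) (funext fun j => ?_)⟩
    change F.basisVec q j = b j
    rw [F.basisVec_act hq, hc, hce]
    congr 1
    funext i
    exact S.mat_eq_iff.1 hf3 i j

/-- `F.emb` identifies the torsor with a definable subset of `Y × V^n`. The anchor is then the first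
coordinate, and the action is a statement about linear combinations. -/
theorem Frame.exists_imagSort (F : Frame G T) {L : Language} {M : Type*} [L.Structure M]
    [ImagSort L M k] [DefField L M k] [ImagSort L M G.Total] [DefTotal G L M] :
    ∃ _ : ImagSort L M P, DefMap L M (fun p => anch T p) ∧
      Def L M fun s : P × Arrow D × P => ActsTo T s.1 s.2.1 s.2.2 := by
  have hproj := DefTotal.proj (G := G) (L := L) (M := M)
  have hrange : Def L M fun a => ∃ p, F.emb p = a := by
    refine (Def.and (Def.forall_finite fun j => Def.eq (hproj.comp ?_) ?_) (Def.and
      (Def.forall_finite fun l => Def.forall_finite fun j => Def.exists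
        (S := fun (a : D.Y × (Fin D.n → G.Total)) s => G.OpRel l (a.2 j, s) ∧
          G.CombRel D.n (fun i => a.1.t l i j, a.2, s)) (Def.and
        ((DefTotal.op l).comp ?_) ((def_combRel D.n).comp ?_)))
      (Def.exists_finite fun j => Def.not (DefTotal.smul.comp ?_)))).congr
      fun a => F.exists_emb_eq_iff
    all_goals fun_prop
  let _ := ImagSort.ofInjective F.emb F.emb_injective hrange
  have hd : DefMap L M F.emb := DefMap.ofInjective F.emb F.emb_injective hrange
  have hanch : DefMap L M (fun p => anch T p) := DefMap.fst hd
  have hbasis : DefMap L M F.basisVec := DefMap.snd hd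
  refine ⟨inferInstance, hanch, ?_⟩
  refine (Def.and (Def.eq ?_ ?_) (Def.and (Def.eq ?_ ?_) (Def.forall_finite fun j =>
    (def_combRel D.n).comp (DefMap.prodMk ?_ (DefMap.prodMk ?_
      (DefMap.apply (hbasis.comp ?_) j)))))).congr fun s => F.actsTo_iff
  all_goals fun_prop

/-- A generalised imaginary sort is interpretable wherever the torsor is an imaginary sort with
definable anchor map and action. -/
theorem _root_.QZGCover.interpretableOver_torsor {L : Language} {M : Type*} [L.Structure M]
    [Nontrivial M] [ImagSort L M k] [DefField L M k] [ImagSort L M P]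
    (T : S.splittingGroupoid.Torsor P) (hanch : DefMap L M (fun p => anch T p))
    (hact : Def L M fun s : P × Arrow D × P => ActsTo T s.1 s.2.1 s.2.2)
    {a : k → M} (ha : DefMap L M a) :
    InterpretableOver L M T.lang T.Carrier a T.ofField := by
  let _ : ImagSort L M T.Carrier := inferInstanceAs (ImagSort L M (k ⊕ P))
  have hk : DefMap L M T.ofField := DefMap.inl (E := k) (F := P)
  have hp : DefMap L M T.ofPoint := DefMap.inr (E := k) (F := P)
  refine interpretableOver_of_imagSort (fun {j} R => ?_) (fun f => Empty.elim f) a T.ofField ?_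
  · change ImagRel (D.m + D.d * (D.n * D.n))
      (D.m + D.d * (D.n * D.n) + (D.m + D.d * (D.n * D.n)) + 1) D.m j at R
    cases R with
    | isField =>
      refine Def.exists (S := fun (x : Fin 1 → T.Carrier) c => x 0 = T.ofField c) (Def.eq ?_ ?_)
      all_goals fun_prop
    | add =>
      refine Def.exists (S := fun (x : Fin 3 → T.Carrier) c => ∃ c', x =
        ![T.ofField c, T.ofField c', T.ofField (c + c')]) (Def.exists (Def.eq ?_ ?_))
      all_goals fun_prop
    | mul =>
      refine Def.exists (S := fun (x : Fin 3 → T.Carrier) c => ∃ c', x =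
        ![T.ofField c, T.ofField c', T.ofField (c * c')]) (Def.exists (Def.eq ?_ ?_))
      all_goals fun_prop
    | anchor =>
      refine Def.exists (S := fun (x : Fin (D.m + D.d * (D.n * D.n) + 1) → T.Carrier) p => x =
        Fin.cons (T.ofPoint p) fun i => T.ofField (yCode (anch T p) i)) (Def.eq ?_ ?_)
      all_goals fun_prop
    | proj =>
      refine Def.exists (S := fun (x : Fin (D.m + 1) → T.Carrier) p => x =
        Fin.cons (T.ofPoint p) fun i => T.ofField (D.xCode (anch T p).x i)) (Def.eq ?_ ?_)
      all_goals fun_prop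
    | act =>
      refine (Def.exists (S := fun (x : Fin (D.m + D.d * (D.n * D.n) +
          (D.m + D.d * (D.n * D.n)) + 1 + 2) → T.Carrier) (s : P × Arrow D × P) =>
        ActsTo T s.1 s.2.1 s.2.2 ∧ x = Fin.cons (T.ofPoint s.1) (Fin.cons (T.ofPoint s.2.2)
          fun i => T.ofField (arrCode s.2.1 i))) (Def.and (hact.comp ?_) (Def.eq ?_ ?_))).congr
        fun x => ?_
      iterate 3 fun_prop
      constructor
      · rintro ⟨p, f, e, h⟩
        exact ⟨(p, f, T.act p f e), ⟨e, rfl⟩, h⟩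
      · rintro ⟨s, ⟨e, h⟩, h'⟩
        rw [← h] at h'
        exact ⟨s.1, s.2.1, e, h'⟩
  · refine Def.exists (S := fun (p : M × T.Carrier) c => p.1 = a c ∧ p.2 = T.ofField c)
      (Def.and (Def.eq ?_ ?_) (Def.eq ?_ ?_))
    all_goals fun_prop

end QZGeometry

open QZGeometry

/-! ## The three structures -/

section Structures

theorem Def.relMap_comp {L : Language} {M : Type*} [L.Structure M] {E : Type*} [ImagSort L M E]
    {j : ℕ} (R : L.Relations j) {f : E → Fin j → M} (hf : DefMap L M f) :
    Def L M fun e => Language.Structure.RelMap R (f e) :=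
  (Def.relMap R).comp hf

variable {k : Type u} {A : Type v} [Field k] [Ring A] [Algebra k A] {D : QZGData.{u, v, w} k A}

/-! ### The geometry -/

namespace QZGeometry

variable (G : QZGeometry.{u, v, w, w₁} D)

theorem ofField_injective : Function.Injective G.ofField := Sum.inl_injective

instance : Nontrivial G.Carrier := G.ofField_injective.nontrivial

theorem def_range_ofField :
    Def (geomLang D.m D.d) G.Carrier fun a => ∃ c, G.ofField c = a := by
  refine (Def.relMap_comp (L := geomLang D.m D.d) (j := 1) GeomRel.isField
    (f := fun a : G.Carrier => ![a]) (by fun_prop)).congr fun a => ?_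
  exact exists_congr fun c => eq_comm

/-- The field sort of the geometry. -/
@[reducible]
def imagSortField : ImagSort (geomLang D.m D.d) G.Carrier k :=
  ImagSort.ofInjective G.ofField G.ofField_injective G.def_range_ofField

theorem defMap_ofField :
    letI := G.imagSortField
    DefMap (geomLang D.m D.d) G.Carrier G.ofField :=
  DefMap.ofInjective G.ofField G.ofField_injective G.def_range_ofField

theorem defField :
    letI := G.imagSortField
    DefField (geomLang D.m D.d) G.Carrier k := by
  let _ := G.imagSortField
  have hk := G.defMap_ofField
  constructor
  · refine (Def.relMap_comp (L := geomLang D.m D.d) (j := 3) GeomRel.add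
      (f := fun s : (k × k) × k => ![G.ofField s.1.1, G.ofField s.1.2, G.ofField s.2])
      (by fun_prop)).congr ?_
    rintro ⟨⟨a, b⟩, c⟩
    constructor
    · intro h
      obtain rfl : a + b = c := h
      exact ⟨a, b, rfl⟩
    · rintro ⟨a', b', h⟩
      obtain rfl := G.ofField_injective (congrFun h 0)
      obtain rfl := G.ofField_injective (congrFun h 1)
      exact (G.ofField_injective (congrFun h 2)).symm
  · refine (Def.relMap_comp (L := geomLang D.m D.d) (j := 3) GeomRel.mul
      (f := fun s : (k × k) × k => ![G.ofField s.1.1, G.ofField s.1.2, G.ofField s.2])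
      (by fun_prop)).congr ?_
    rintro ⟨⟨a, b⟩, c⟩
    constructor
    · intro h
      obtain rfl : a * b = c := h
      exact ⟨a, b, rfl⟩
    · rintro ⟨a', b', h⟩
      obtain rfl := G.ofField_injective (congrFun h 0)
      obtain rfl := G.ofField_injective (congrFun h 1)
      exact (G.ofField_injective (congrFun h 2)).symm

/-- The inclusion of the sort `V`. -/
def ofTotal : G.Total → G.Carrier := Sum.inr

theorem ofTotal_injective : Function.Injective G.ofTotal := Sum.inr_injective

/-- The language names only the field sort; `V` is its complement. -/
theorem def_range_ofTotal :
    Def (geomLang D.m D.d) G.Carrier fun a => ∃ s, G.ofTotal s = a := by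
  refine G.def_range_ofField.not.congr fun a => ?_
  rcases a with c | s
  · refine iff_of_false ?_ (not_not.2 ⟨c, rfl⟩)
    rintro ⟨s, h⟩
    cases h
  · refine iff_of_true ⟨s, rfl⟩ ?_
    rintro ⟨c, h⟩
    cases h

/-- The sort `V` of the geometry. -/
@[reducible]
def imagSortTotal : ImagSort (geomLang D.m D.d) G.Carrier G.Total :=
  ImagSort.ofInjective G.ofTotal G.ofTotal_injective G.def_range_ofTotal

theorem defTotal :
    letI := G.imagSortField
    letI := G.imagSortTotal
    DefTotal G (geomLang D.m D.d) G.Carrier := by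
  let _ := G.imagSortField
  let _ := G.imagSortTotal
  have hk := G.defMap_ofField
  have hv : DefMap (geomLang D.m D.d) G.Carrier G.ofTotal :=
    DefMap.ofInjective G.ofTotal G.ofTotal_injective G.def_range_ofTotal
  have hi := G.ofTotal_injective
  refine ⟨?_, ?_, ?_, fun l => ?_⟩
  · refine (Def.relMap_comp (L := geomLang D.m D.d) (j := D.m + 1) GeomRel.proj
      (f := fun s : G.Total × (Fin D.m → k) => Fin.cons (G.ofTotal s.1) fun i => G.ofField (s.2 i))
      (by fun_prop)).congr ?_
    rintro ⟨⟨x, a⟩, c⟩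
    constructor
    · intro h
      obtain rfl : D.xCode x = c := h
      exact ⟨x, a, rfl⟩
    · rintro ⟨x', a', h⟩
      obtain ⟨h1, h2⟩ := Fin.cons_injective2 h
      have h3 : x = x' := congrArg Sigma.fst (hi h1)
      subst h3
      exact funext fun i => (G.ofField_injective (congrFun h2 i)).symm
  · refine (Def.relMap_comp (L := geomLang D.m D.d) (j := 3) GeomRel.vadd
      (f := fun s : G.Total × G.Total × G.Total =>
        ![G.ofTotal s.1, G.ofTotal s.2.1, G.ofTotal s.2.2]) (by fun_prop)).congr ?_
    rintro ⟨s1, s2, s3⟩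
    constructor
    · rintro ⟨x, a, b, h⟩
      cases h
      exact ⟨x, a, b, rfl⟩
    · rintro ⟨x, a, b, h⟩
      exact ⟨x, a, b, Prod.ext (hi (congrFun h 0))
        (Prod.ext (hi (congrFun h 1)) (hi (congrFun h 2)))⟩
  · refine (Def.relMap_comp (L := geomLang D.m D.d) (j := 3) GeomRel.smul
      (f := fun s : k × G.Total × G.Total =>
        ![G.ofField s.1, G.ofTotal s.2.1, G.ofTotal s.2.2]) (by fun_prop)).congr ?_
    rintro ⟨s1, s2, s3⟩
    constructor
    · rintro ⟨c, x, a, h⟩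
      cases h
      exact ⟨_, x, a, rfl⟩
    · rintro ⟨c, x, a, h⟩
      exact ⟨c, x, a, Prod.ext (G.ofField_injective (congrFun h 0))
        (Prod.ext (hi (congrFun h 1)) (hi (congrFun h 2)))⟩
  · refine (Def.relMap_comp (L := geomLang D.m D.d) (j := 2) (GeomRel.op l)
      (f := fun s : G.Total × G.Total => ![G.ofTotal s.1, G.ofTotal s.2]) (by fun_prop)).congr ?_
    rintro ⟨s1, s2⟩
    constructor
    · rintro ⟨x, a, h⟩
      cases h
      exact ⟨x, a, rfl⟩
    · rintro ⟨x, a, h⟩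
      exact ⟨x, a, Prod.ext (hi (congrFun h 0)) (hi (congrFun h 1))⟩

end QZGeometry

/-! ### The pure field -/

instance defField_ring : DefField Language.ring k k := by
  -- The pure field structure is the one underlying this instance, which makes `+` and `*` available
  -- as terms of the ring language with their usual meaning.
  let _ := FirstOrder.Ring.compatibleRingOfRing k
  constructor
  · refine (((def_iff_definable (L := Language.ring) (S := {v : Fin 3 → k | v 0 + v 1 = v 2})).2
      (Set.Definable.mono (Set.empty_definable_iff.2
        ⟨Language.Term.equal (Language.var 0 + Language.var 1) (Language.var 2), ?_⟩)
        (Set.empty_subset _))).comp (f := fun s : (k × k) × k => ![s.1.1, s.1.2, s.2])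
        (by fun_prop)).congr fun s => Iff.rfl
    ext v
    simp
  · refine (((def_iff_definable (L := Language.ring) (S := {v : Fin 3 → k | v 0 * v 1 = v 2})).2
      (Set.Definable.mono (Set.empty_definable_iff.2
        ⟨Language.Term.equal (Language.var 0 * Language.var 1) (Language.var 2), ?_⟩)
        (Set.empty_subset _))).comp (f := fun s : (k × k) × k => ![s.1.1, s.1.2, s.2])
        (by fun_prop)).congr fun s => Iff.rfl
    ext v
    simp

theorem FieldDefinable.of_def {α : Type} [Finite α] {s : Set (α → k)}
    (h : Def Language.ring k fun v => v ∈ s) : FieldDefinable k s :=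
  def_iff_definable.1 h

theorem FieldDefinable.range {E : Type*} [ImagSort Language.ring k E] {α : Type} [Finite α]
    {f : E → α → k} (hf : DefMap Language.ring k f) : FieldDefinable k (Set.range f) :=
  .of_def (Def.exists (S := fun v e => f e = v) (Def.eq (by fun_prop) (by fun_prop)))

variable [IsAlgClosed k] {Γ : Type w'} [Group Γ] [MulAction Γ D.Y] {S : QZGCover D Γ}

/-- A generalised imaginary sort is interpretable in the geometry. -/
theorem QZGCover.interpretableOver_imag_geometry (G : QZGeometry.{u, v, w, w₁} D) {P : Type w₂}
    (T : S.splittingGroupoid.Torsor P) :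
    InterpretableOver (geomLang D.m D.d) G.Carrier T.lang T.Carrier G.ofField T.ofField := by
  let _ := G.imagSortField
  let _ := G.imagSortTotal
  have := G.defField
  have := G.defTotal
  obtain ⟨F⟩ := exists_frame G T
  obtain ⟨_, hanch, hact⟩ := F.exists_imagSort (L := geomLang D.m D.d) (M := G.Carrier)
  exact interpretableOver_torsor T hanch hact G.defMap_ofField

/-- The geometry is interpretable wherever a torsor is an imaginary sort with definable anchor map
and action. -/
theorem QZGCover.interpretableOver_of_torsor (G : QZGeometry.{u, v, w, w₁} D) {P : Type w₂}
    (T : S.splittingGroupoid.Torsor P) {L : Language} {M : Type*} [L.Structure M] [Nontrivial M]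
    [ImagSort L M k] [DefField L M k] [ImagSort L M P] (hanch : DefMap L M (fun p => anch T p))
    (hact : Def L M fun s : P × Arrow D × P => ActsTo T s.1 s.2.1 s.2.2)
    {a : k → M} (ha : DefMap L M a) :
    InterpretableOver L M (geomLang D.m D.d) G.Carrier a G.ofField := by
  obtain ⟨F⟩ := exists_frame G T
  obtain ⟨_, _⟩ := F.exists_defTotal hanch hact
  exact interpretableOver_geometry G L M ha

/-! ### Generalised imaginary sorts -/

section Imag

variable {P : Type w₂} (T : S.splittingGroupoid.Torsor P)

theorem TupleGroupoid.Torsor.ofField_injective : Function.Injective T.ofField := Sum.inl_injective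

theorem TupleGroupoid.Torsor.ofPoint_injective : Function.Injective T.ofPoint := Sum.inr_injective

theorem TupleGroupoid.Torsor.def_range_ofField : Def T.lang T.Carrier fun a => ∃ c, T.ofField c = a := by
  refine (Def.relMap_comp (L := T.lang) (j := 1) ImagRel.isField
    (f := fun a : T.Carrier => ![a]) (by fun_prop)).congr fun a => ?_
  exact exists_congr fun c => eq_comm

theorem TupleGroupoid.Torsor.def_range_ofPoint : Def T.lang T.Carrier fun a => ∃ p, T.ofPoint p = a := by
  refine T.def_range_ofField.not.congr fun a => ?_
  rcases a with c | s
  · refine iff_of_false ?_ (not_not.2 ⟨c, rfl⟩)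
    rintro ⟨s, h⟩
    cases h
  · refine iff_of_true ⟨s, rfl⟩ ?_
    rintro ⟨c, h⟩
    cases h

/-- The geometry is interpretable in a generalised imaginary sort. -/
theorem QZGCover.interpretableOver_geometry_imag (G : QZGeometry.{u, v, w, w₁} D) :
    InterpretableOver T.lang T.Carrier (geomLang D.m D.d) G.Carrier T.ofField G.ofField := by
  have hki := T.ofField_injective
  have hpi := T.ofPoint_injective
  let _ : ImagSort T.lang T.Carrier k :=
    ImagSort.ofInjective T.ofField hki T.def_range_ofField
  let _ : ImagSort T.lang T.Carrier P :=
    ImagSort.ofInjective T.ofPoint hpi T.def_range_ofPoint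
  have hk : DefMap T.lang T.Carrier T.ofField :=
    DefMap.ofInjective T.ofField hki T.def_range_ofField
  have hp : DefMap T.lang T.Carrier T.ofPoint :=
    DefMap.ofInjective T.ofPoint hpi T.def_range_ofPoint
  have : Nontrivial T.Carrier := hki.nontrivial
  have : DefField T.lang T.Carrier k := by
    constructor
    · refine (Def.relMap_comp (L := T.lang) (j := 3) ImagRel.add
        (f := fun s : (k × k) × k => ![T.ofField s.1.1, T.ofField s.1.2, T.ofField s.2])
        (by fun_prop)).congr ?_
      rintro ⟨⟨a, b⟩, c⟩
      constructor
      · intro h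
        obtain rfl : a + b = c := h
        exact ⟨a, b, rfl⟩
      · rintro ⟨a', b', h⟩
        obtain rfl := hki (congrFun h 0)
        obtain rfl := hki (congrFun h 1)
        exact (hki (congrFun h 2)).symm
    · refine (Def.relMap_comp (L := T.lang) (j := 3) ImagRel.mul
        (f := fun s : (k × k) × k => ![T.ofField s.1.1, T.ofField s.1.2, T.ofField s.2])
        (by fun_prop)).congr ?_
      rintro ⟨⟨a, b⟩, c⟩
      constructor
      · intro h
        obtain rfl : a * b = c := h
        exact ⟨a, b, rfl⟩
      · rintro ⟨a', b', h⟩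
        obtain rfl := hki (congrFun h 0)
        obtain rfl := hki (congrFun h 1)
        exact (hki (congrFun h 2)).symm
  -- The language gives the anchor only through its coordinates in `k`; injectivity of the coding
  -- recovers the point of `Y`. The arrow in the action is recovered likewise.
  have hanch : DefMap T.lang T.Carrier fun p => anch T p := by
    refine (Def.relMap_comp (L := T.lang) (j := D.m + D.d * (D.n * D.n) + 1) ImagRel.anchor
      (f := fun s : P × D.Y => Fin.cons (T.ofPoint s.1) fun i => T.ofField (yCode s.2 i))
      (by fun_prop)).congr ?_
    rintro ⟨p, y⟩
    constructor
    · intro h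
      obtain rfl : anch T p = y := h
      exact ⟨p, rfl⟩
    · rintro ⟨q, h⟩
      obtain ⟨h1, h2⟩ := Fin.cons_injective2 h
      obtain rfl := hpi h1
      exact (yCode_injective (funext fun i => hki (congrFun h2 i))).symm
  have hact : Def T.lang T.Carrier fun s : P × Arrow D × P => ActsTo T s.1 s.2.1 s.2.2 := by
    refine (Def.relMap_comp (L := T.lang)
      (j := D.m + D.d * (D.n * D.n) + (D.m + D.d * (D.n * D.n)) + 1 + 2) ImagRel.act
      (f := fun s : P × Arrow D × P => Fin.cons (T.ofPoint s.1) (Fin.cons (T.ofPoint s.2.2)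
        fun i => T.ofField (arrCode s.2.1 i))) (by fun_prop)).congr ?_
    intro s
    constructor
    · rintro ⟨e, h⟩
      exact ⟨s.1, s.2.1, e, by rw [h]; rfl⟩
    · rintro ⟨p, f, e, h⟩
      obtain ⟨h1, h2⟩ := Fin.cons_injective2 h
      obtain ⟨h2, h3⟩ := Fin.cons_injective2 h2
      have h4 : s.2.1 = (f : Arrow D) := arrCode_injective (funext fun i => hki (congrFun h3 i))
      rw [hpi h1, h4, hpi h2]
      exact ⟨e, rfl⟩
  exact interpretableOver_of_torsor G T hanch hact hk

end Imag

-- The structure maps were shown definable over any definable field; here they are specialised to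
-- the pure field, and each required set is the image of a definable set under a coding.
variable (S) in
theorem QZGCover.isDefinable_splittingGroupoid : S.splittingGroupoid.IsDefinable where
  obj := FieldDefinable.range (f := yCode (D := D)) (by fun_prop)
  arr := FieldDefinable.range (f := arrCode (D := D)) (by fun_prop)
  src := FieldDefinable.range (f := fun p : Arrow D => Sum.elim (arrCode p) (yCode p.src))
    (by fun_prop)
  tgt := FieldDefinable.range (f := fun p : Arrow D => Sum.elim (arrCode p) (yCode p.tgt))
    (by fun_prop)
  one := by
    have := S.defMap_one (L := Language.ring) (M := k)
    exact FieldDefinable.range (f := fun y : D.Y => Sum.elim (yCode y) (arrCode (S.one y)))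
      (by fun_prop)
  inv := by
    have := S.defMap_inv (L := Language.ring) (M := k)
    exact FieldDefinable.range (f := fun p : Arrow D => Sum.elim (arrCode p) (arrCode (S.inv p)))
      (by fun_prop)
  comp := by
    refine FieldDefinable.of_def ((Def.exists (S := fun v (p : Arrow D × Arrow D × Arrow D) =>
      (∃ h, S.comp p.1 p.2.1 h = p.2.2) ∧
        v = Sum.elim (arrCode p.1) (Sum.elim (arrCode p.2.1) (arrCode p.2.2)))
      (Def.and (S.def_comp.comp ?_) (Def.eq ?_ ?_))).congr fun v => ?_)
    iterate 3 fun_prop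
    constructor
    · rintro ⟨f, h, e, hv⟩
      exact ⟨(f, h, S.comp f h e), ⟨e, rfl⟩, hv⟩
    · rintro ⟨s, ⟨e, h1⟩, hv⟩
      rw [← h1] at hv
      exact ⟨s.1, s.2.1, e, hv⟩
  quot := FieldDefinable.range (f := fun y : D.Y => Sum.elim (yCode y) (D.xCode y.x))
    (by fun_prop)

/-- If the splitting groupoid is eliminable, the geometry is interpretable in the pure field. -/
theorem QZGCover.interpretableOver_of_eliminable (G : QZGeometry.{u, v, w, w₁} D)
    (h : S.splittingGroupoid.Eliminable) :
    InterpretableOver Language.ring k (geomLang D.m D.d) G.Carrier (id : k → k) G.ofField := by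
  obtain ⟨r, P, T, hP, hanch, -, hact⟩ := h
  have hr : Def Language.ring k fun v : Fin r → k => ∃ p : P, p.1 = v :=
    (def_iff_definable.2 hP).congr fun v => ⟨fun ⟨p, h⟩ => h ▸ p.2, fun h => ⟨⟨v, h⟩, rfl⟩⟩
  -- A definable torsor is a subsort of a power of `k`, so the argument for generalised imaginary
  -- sorts applies with the pure field as ambient structure.
  let _ : ImagSort Language.ring k P :=
    ImagSort.ofInjective (fun p : P => p.1) Subtype.val_injective hr
  have hval : DefMap Language.ring k (fun p : P => p.1) :=
    DefMap.ofInjective (fun p : P => p.1) Subtype.val_injective hr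
  have hanch' : DefMap Language.ring k fun p : P => anch T p := by
    refine ((def_iff_definable.2 hanch).comp
      (f := fun s : P × D.Y => Sum.elim s.1.1 (yCode s.2)) (by fun_prop)).congr ?_
    rintro ⟨p, y⟩
    constructor
    · intro h
      obtain rfl : anch T p = y := h
      exact ⟨p, rfl⟩
    · rintro ⟨q, h⟩
      obtain rfl : q = p := Subtype.val_injective (congrArg (· ∘ Sum.inl) h)
      exact yCode_injective (congrArg (· ∘ Sum.inr) h)
  have hact' : Def Language.ring k fun s : P × Arrow D × P => ActsTo T s.1 s.2.1 s.2.2 := by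
    refine ((def_iff_definable.2 hact).comp
      (f := fun s : P × Arrow D × P => Sum.elim s.1.1 (Sum.elim (arrCode s.2.1) s.2.2.1))
      (by fun_prop)).congr ?_
    intro s
    constructor
    · rintro ⟨e, h⟩
      exact ⟨s.1, s.2.1, e, by rw [h]; rfl⟩
    · rintro ⟨p, f, e, h⟩
      have h1 : s.1 = p := Subtype.val_injective (congrArg (· ∘ Sum.inl) h)
      have h2 : s.2.1 = (f : Arrow D) :=
        arrCode_injective (congrArg (fun v => (v ∘ Sum.inr) ∘ Sum.inl) h)
      have h3 : s.2.2 = T.act p f e :=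
        Subtype.val_injective (congrArg (fun v => (v ∘ Sum.inr) ∘ Sum.inr) h)
      rw [h1, h2, h3]
      exact ⟨e, rfl⟩
  exact interpretableOver_of_torsor G T hanch' hact' DefMap.id

end Structures

theorem mainTheorem2 {k : Type u} [Field k] [IsAlgClosed k] {A : Type v} [Ring A] [Algebra k A]
    (D : QZGData.{u, v, w} k A) {Γ : Type w'} [Group Γ] [MulAction Γ D.Y] (S : QZGCover D Γ)
    (G : QZGeometry.{u, v, w, w₁} D) :
    S.splittingGroupoid.IsDefinable ∧
    (∃ P : Type (max u v), Nonempty (S.splittingGroupoid.Torsor P)) ∧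
    (∀ (P : Type w₂) (T : S.splittingGroupoid.Torsor P),
      InterpretableOver (geomLang D.m D.d) G.Carrier T.lang T.Carrier G.ofField T.ofField ∧
      InterpretableOver T.lang T.Carrier (geomLang D.m D.d) G.Carrier T.ofField G.ofField) ∧
    (S.splittingGroupoid.Eliminable →
      InterpretableOver Language.ring k (geomLang D.m D.d) G.Carrier (id : k → k) G.ofField) :=
  ⟨S.isDefinable_splittingGroupoid, S.exists_torsor,
    fun _ T => ⟨interpretableOver_imag_geometry G T, interpretableOver_geometry_imag T G⟩,
    interpretableOver_of_eliminable G⟩
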